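/- Let $E>0$, $\nu\in(-1,\tfrac12)$ and let $\lambda=\frac{E\nu}{(1+\nu)(1-2\nu)}$, $\mu=\frac{E}{2(1+\nu)}$ be the Lamé constants. Let $0<a<\epsilon<b$, $h>0$, $p\ge 0$, let $k\ge1$ be odd and put $\kappa=\frac{\pi k}{h}$. Let $\Psi_k(\rho)=(-1)^{\frac{k+1}{2}}\frac4h\,p$ for $a<\rho<\epsilon$ and $\Psi_k(\rho)=0$ for all other $\rho>0$. Consider the system $$\begin{cases} Y''+\dfrac{Y'}{\rho}-\dfrac{Y}{\rho^2}-\dfrac{\mu}{\lambda+2\mu}\kappa^2Y+\dfrac{\lambda+\mu}{\lambda+2\mu}\kappa Z'=0,\\[6pt] Z''+\dfrac{Z'}{\rho}-\dfrac{\lambda+2\mu}{\mu}\kappa^2Z-\dfrac{\lambda+\mu}{\mu}\kappa\Big[Y'+\dfrac{Y}{\rho}\Big]=-\dfrac1\mu\Psi_k,\end{cases}\qquad(1)$$ and the boundary value problem $(2)$ consisting of $(1)$ in $(a,b)$ and of the boundary conditions $$(\lambda+2\mu)Y'+\tfrac{\lambda}{\rho}Y+\lambda\kappa Z=0,\qquad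 Z'-\kappa Y=0\qquad\text{at }\rho=a\text{ and }\rho=b .$$ A solution of $(2)$ is a pair $(Y,Z)\in H^1(a,b;\mathbb R^2)$ satisfying its variational formulation: for all $(H,K)\in H^1(a,b;\mathbb R^2)$, $$2\mu\int_a^b\Big[\rho Y'H'+\frac{YH}{\rho}\Big]d\rho+\lambda\int_a^b\rho\Big[Y'+\frac Y\rho+\kappa Z\Big]\Big[H'+\frac H\rho+\kappa K\Big]d\rho+\mu\int_a^b\rho[Z'-\kappa Y][K'-\kappa H]\,d\rho+2\mu\kappa^2\int_a^b\rho ZK\,d\rho=\int_a^b\rho\Psi_kK\,d\rho .$$ The homogeneous system is $(1)$ on $(0,\infty)$ with $\Psi_k$ replaced by $0$; its solutions are twice differentiable pairs. 1. Problem $(2)$ has a unique solution $\Upsilon=(Y,Z)$ (up to equality almost everywhere in $(a,b)$). 2. Let $\Upsilon^j=(Y^j,Z^j)$, $j=1,\dots,4$, be any four solutions of the homogeneous system that are linearly independent on $(0,\infty)$, and let $\mathbf W(\rho)$ be their Wronskian matrix, with $j$-th column $(Y^j,(Y^j)',Z^j,(Z^j)')^T$. Then $\mathbf W(\rho)$ is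 invertible for every $\rho>0$, the integrand below is integrable between $a$ and every $\rho>0$, and the formula $$\big(\overline Y(\rho),\overline Y'(\rho),\overline Z(\rho),\overline Z'(\rho)\big)^T=\mathbf W(\rho)\int_a^\rho\mathbf W(r)^{-1}\big(0,0,0,-\tfrac1\mu\Psi_k(r)\big)^Tdr,\qquad \rho>0,$$ defines differentiable functions $\overline Y,\overline Z$ on $(0,\infty)$, with derivatives the second and the fourth component of the right-hand side; the pair $\overline\Upsilon=(\overline Y,\overline Z)$ satisfies $(1)$ at every $\rho>0$ with $\rho\ne a,\epsilon$. There is a unique $(C_1,C_2,C_3,C_4)\in\mathbb R^4$ such that $$\Upsilon(\rho)=C_1\Upsilon^1(\rho)+C_2\Upsilon^2(\rho)+C_3\Upsilon^3(\rho)+C_4\Upsilon^4(\rho)+\overline\Upsilon(\rho)\qquad\text{for almost every }\rho\in(a,b).$$ 3. Every solution $(Y,Z)$ of the homogeneous system (in particular each $\Upsilon^j$) can be written as $$Y(\rho)=\sum_{n=-1}^{\infty}a_n\rho^n+(\ln\rho)\sum_{n=0}^{\infty}b_n\rho^n,\qquad Z(\rho)=\sum_{n=0}^{\infty}c_n\rho^n+(\ln\rho)\sum_{n=0}^{\infty}d_n\rho^n,\qquad(3)$$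 with the four series convergent for every $\rho>0$, and the coefficients are uniquely determined by $(Y,Z)$. Moreover, for every choice of $(a_{-1},a_1,b_1,c_0)\in\mathbb R^4$ there is exactly one choice of the remaining coefficients such that the series in $(3)$ converge for every $\rho>0$ and $(3)$ defines a solution of the homogeneous system; the choices of $(a_{-1},a_1,b_1,c_0)$ equal to the four unit vectors of $\mathbb R^4$ give four linearly independent solutions. -/

import Mathlib

noncomputable section

namespace HollowCylinder

open MeasureTheory Set

/-- `v` is a weak derivative of `u` on the interval `(a, b)`. -/
def HasWeakDerivOn (a b : ℝ) (u v : ℝ → ℝ) : Prop :=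
  ∀ φ : ℝ → ℝ, ContDiff ℝ (⊤ : ℕ∞) φ → HasCompactSupport φ → tsupport φ ⊆ Ioo a b →
    ∫ x in Ioo a b, u x * deriv φ x = -∫ x in Ioo a b, v x * φ x

/-- `u` belongs to the Sobolev space `H¹(a, b)`, with weak derivative `v`. -/
structure IsH1With (a b : ℝ) (u v : ℝ → ℝ) : Prop where
  memLp : MemLp u 2 (volume.restrict (Ioo a b))
  memLp_deriv : MemLp v 2 (volume.restrict (Ioo a b))
  weakDeriv : HasWeakDerivOn a b u v

/-- Radial profile of the load: `p` for `a < ρ < ε`, extended by zero to all other radii. -/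
def load (a ε p : ℝ) (ρ : ℝ) : ℝ :=
  if a < ρ ∧ ρ < ε then p else 0

/-- The right-hand side `Ψ_k` as a function of the radius, extended by zero outside `(a, b)`
(here `ε < b`). -/
def Psi (a ε h p : ℝ) (k : ℕ) (ρ : ℝ) : ℝ :=
  if Odd k then (-1) ^ ((k + 1) / 2) * (4 / h) * load a ε p ρ else 0

/-- `(Y, Z) ∈ H¹(a, b; ℝ²)` is a (weak) solution of the radial boundary value problem
with frequency `κ = π k / h` and right-hand side `Ψ = g`: the variational formulation tested with
all `(H, K) ∈ H¹(a, b; ℝ²)`, which contains the two boundary conditions at `a` and at `b` as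
natural boundary conditions. Here `Y', Z', H', K'` are the weak derivatives. -/
def IsRadialBVPSolution (a b lam mu κ : ℝ) (g : ℝ → ℝ) (Y Z : ℝ → ℝ) : Prop :=
  ∃ Y' Z' : ℝ → ℝ, IsH1With a b Y Y' ∧ IsH1With a b Z Z' ∧
    ∀ H H' K K' : ℝ → ℝ, IsH1With a b H H' → IsH1With a b K K' →
      2 * mu * (∫ ρ in Ioo a b, (ρ * Y' ρ * H' ρ + Y ρ * H ρ / ρ))
      + lam * (∫ ρ in Ioo a b,
          ρ * (Y' ρ + Y ρ / ρ + κ * Z ρ) * (H' ρ + H ρ / ρ + κ * K ρ))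
      + mu * (∫ ρ in Ioo a b, ρ * (Z' ρ - κ * Y ρ) * (K' ρ - κ * H ρ))
      + 2 * mu * κ ^ 2 * (∫ ρ in Ioo a b, ρ * Z ρ * K ρ)
      = ∫ ρ in Ioo a b, ρ * g ρ * K ρ

/-- At the point `ρ`, the pair `(Y, Z)` is twice differentiable and satisfies the two ordinary
differential equations of the radial system, with the value `g` of `Ψ` at `ρ`. -/
structure SolvesRadialSystemAt (lam mu κ g : ℝ) (Y Z : ℝ → ℝ) (ρ : ℝ) : Prop where
  diffY : ∀ᶠ r in nhds ρ, DifferentiableAt ℝ Y r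
  diffZ : ∀ᶠ r in nhds ρ, DifferentiableAt ℝ Z r
  diffY' : DifferentiableAt ℝ (deriv Y) ρ
  diffZ' : DifferentiableAt ℝ (deriv Z) ρ
  eqY : deriv (deriv Y) ρ + deriv Y ρ / ρ - Y ρ / ρ ^ 2
      - mu / (lam + 2 * mu) * κ ^ 2 * Y ρ + (lam + mu) / (lam + 2 * mu) * κ * deriv Z ρ = 0
  eqZ : deriv (deriv Z) ρ + deriv Z ρ / ρ - (lam + 2 * mu) / mu * κ ^ 2 * Z ρ
      - (lam + mu) / mu * κ * (deriv Y ρ + Y ρ / ρ) = -(1 / mu) * g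

/-- `(Y, Z)` solves the homogeneous radial system on `(0, ∞)`. -/
def IsHomogeneousSolution (lam mu κ : ℝ) (Y Z : ℝ → ℝ) : Prop :=
  ∀ ρ : ℝ, 0 < ρ → SolvesRadialSystemAt lam mu κ 0 Y Z ρ

/-- Four solutions `(Y j, Z j)` of the homogeneous system on `(0, ∞)`, linearly independent as
functions on `(0, ∞)` with values in `ℝ²`. -/
structure IsFundamentalSystem (lam mu κ : ℝ) (Y Z : Fin 4 → ℝ → ℝ) : Prop where
  solves : ∀ j, IsHomogeneousSolution lam mu κ (Y j) (Z j)
  linearIndependent :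
    LinearIndependent ℝ (fun (j : Fin 4) (ρ : Ioi (0 : ℝ)) => ((Y j ρ, Z j ρ) : ℝ × ℝ))

/-- The Wronskian matrix of `(Y j, Z j)`, `j = 0, …, 3`, with rows `Y`, `Y'`, `Z`, `Z'`. -/
def wronskian (Y Z : Fin 4 → ℝ → ℝ) (ρ : ℝ) : Matrix (Fin 4) (Fin 4) ℝ :=
  Matrix.of fun i j => ![Y j ρ, deriv (Y j) ρ, Z j ρ, deriv (Z j) ρ] i

/-- The vector `W(r)⁻¹ (0, 0, 0, -g(r)/μ)ᵀ`. -/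
def variationIntegrand (mu : ℝ) (g : ℝ → ℝ) (Y Z : Fin 4 → ℝ → ℝ) (r : ℝ) : Fin 4 → ℝ :=
  Matrix.mulVec (wronskian Y Z r)⁻¹ ![0, 0, 0, -(1 / mu) * g r]

/-- The vector `W(ρ) ∫ₐ^ρ W(r)⁻¹ (0, 0, 0, -g(r)/μ)ᵀ dr` of variation of constants. Its
components `0`, `1`, `2`, `3` are meant to be `Ȳ`, `Ȳ'`, `Z̄`, `Z̄'`. -/
def particular (a mu : ℝ) (g : ℝ → ℝ) (Y Z : Fin 4 → ℝ → ℝ) (ρ : ℝ) : Fin 4 → ℝ :=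
  Matrix.mulVec (wronskian Y Z ρ) (∫ r in a..ρ, variationIntegrand mu g Y Z r)

/-- The coefficients of a logarithmic expansion: `aNeg = a₋₁`, and `aₙ, bₙ, cₙ, dₙ` for
`n ≥ 0`. -/
structure LogCoeffs where
  aNeg : ℝ
  a : ℕ → ℝ
  b : ℕ → ℝ
  c : ℕ → ℝ
  d : ℕ → ℝ

/-- The four series `∑ aₙ ρⁿ`, `∑ bₙ ρⁿ`, `∑ cₙ ρⁿ`, `∑ dₙ ρⁿ` converge for every `ρ > 0`. -/
def LogCoeffs.Converges (q : LogCoeffs) : Prop :=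
  ∀ ρ : ℝ, 0 < ρ → Summable (fun n => q.a n * ρ ^ n) ∧ Summable (fun n => q.b n * ρ ^ n) ∧
    Summable (fun n => q.c n * ρ ^ n) ∧ Summable (fun n => q.d n * ρ ^ n)

/-- `∑_{n ≥ -1} aₙ ρⁿ + ln ρ ∑_{n ≥ 0} bₙ ρⁿ`. -/
def LogCoeffs.sumY (q : LogCoeffs) (ρ : ℝ) : ℝ :=
  (q.aNeg * ρ⁻¹ + ∑' n, q.a n * ρ ^ n) + Real.log ρ * ∑' n, q.b n * ρ ^ n

/-- `∑_{n ≥ 0} cₙ ρⁿ + ln ρ ∑_{n ≥ 0} dₙ ρⁿ`. -/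
def LogCoeffs.sumZ (q : LogCoeffs) (ρ : ℝ) : ℝ :=
  (∑' n, q.c n * ρ ^ n) + Real.log ρ * ∑' n, q.d n * ρ ^ n

/-- The four free coefficients `(a₋₁, a₁, b₁, c₀)`. -/
def LogCoeffs.free (q : LogCoeffs) : Fin 4 → ℝ :=
  ![q.aNeg, q.a 1, q.b 1, q.c 0]

/-- `(Y, Z)` has on `(0, ∞)` the convergent expansion with coefficients `q`. -/
def HasLogExpansion (q : LogCoeffs) (Y Z : ℝ → ℝ) : Prop :=
  q.Converges ∧ ∀ ρ : ℝ, 0 < ρ → Y ρ = q.sumY ρ ∧ Z ρ = q.sumZ ρ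

end HollowCylinder

end

noncomputable section

namespace HollowCylinder

open MeasureTheory Set

/-! The homogeneous system is a linear first order system for `(Y, Y', Z, Z')` with coefficients
continuous on `(0, ∞)`, so a solution whose Cauchy data vanish at one radius is zero
(`eq_zero_of_linear_ode`). Hence the Wronskian of independent solutions is invertible everywhere,
four of them span all solutions (`IsFundamentalSystem.exists_combination`), and variation of
constants makes sense.

That four independent solutions exist comes from the Frobenius method at the regular singular point
`0`. Multiplied by `ρ²` and written with the Euler operator `θ = ρ d/dρ`, the system has indicial
polynomials `N² - 1` for `Y` and `N²` for `Z`. Their roots `-1, 1` and `0, 0` leave the free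
coefficients and force the logarithms; for `N ≥ 2` the recursion determines everything and gains a
factor `1 / N`, whence convergence on all of `(0, ∞)` (`exists_frobenius_solution`). Letting `ρ → 0`
separates powers from logarithms and makes the coefficients unique (`HasLogExpansion.unique`);
spanning then transfers the expansion to every solution.

Uniqueness for the boundary value problem is an energy argument: the quadratic form dominates `(Y')²
+ (Y/ρ)² + (κZ)²` because `3λ + 2μ > 0` (`IsRadialBVPSolution.unique`). Existence follows by linear
algebra: the four boundary conditions act on the four constants by a square linear map, injective by
that uniqueness and therefore surjective (`IsFundamentalSystem.exists_isRadialBVPSolution`). The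
link between the two is that a classical solution with the boundary conditions satisfies the weak
formulation (`isRadialBVPSolution_of_classical`). -/

/-! ### Reduction to a first order linear system -/

/-- The coefficient matrix of the radial system, written as a first order system for
`(Y, Y', Z, Z')`. -/
def sysMatrix (lam mu κ ρ : ℝ) : Matrix (Fin 4) (Fin 4) ℝ :=
  !![0, 1, 0, 0;
    1 / ρ ^ 2 + mu / (lam + 2 * mu) * κ ^ 2, -(1 / ρ), 0, -((lam + mu) / (lam + 2 * mu) * κ);
    0, 0, 0, 1;
    (lam + mu) / mu * κ / ρ, (lam + mu) / mu * κ, (lam + 2 * mu) / mu * κ ^ 2, -(1 / ρ)]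

/-- The vector `(Y, Y', Z, Z')`. -/
def state (Y Z : ℝ → ℝ) (ρ : ℝ) : Fin 4 → ℝ :=
  ![Y ρ, deriv Y ρ, Z ρ, deriv Z ρ]

theorem wronskian_apply (Y Z : Fin 4 → ℝ → ℝ) (ρ : ℝ) (i j : Fin 4) :
    wronskian Y Z ρ i j = state (Y j) (Z j) ρ i := rfl

theorem SolvesRadialSystemAt.hasDerivAt_state {lam mu κ g ρ : ℝ} {Y Z : ℝ → ℝ}
    (h : SolvesRadialSystemAt lam mu κ g Y Z ρ) :
    HasDerivAt (state Y Z)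
      ((sysMatrix lam mu κ ρ).mulVec (state Y Z ρ) + ![0, 0, 0, -(1 / mu) * g]) ρ := by
  rw [hasDerivAt_pi]
  have hY := h.eqY
  have hZ := h.eqZ
  intro i
  fin_cases i
  · convert! h.diffY.self_of_nhds.hasDerivAt using 1
    simp [sysMatrix, state]
  · convert! h.diffY'.hasDerivAt using 1
    simp [sysMatrix, state]
    linear_combination -hY
  · convert! h.diffZ.self_of_nhds.hasDerivAt using 1
    simp [sysMatrix, state]
  · convert! h.diffZ'.hasDerivAt using 1
    simp [sysMatrix, state]
    linear_combination -hZ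

theorem SolvesRadialSystemAt.of_hasDerivAt {lam mu κ g ρ y z : ℝ} {Y Z Y' Z' : ℝ → ℝ}
    (hY : ∀ᶠ r in nhds ρ, HasDerivAt Y (Y' r) r) (hZ : ∀ᶠ r in nhds ρ, HasDerivAt Z (Z' r) r)
    (hY' : HasDerivAt Y' y ρ) (hZ' : HasDerivAt Z' z ρ)
    (e₁ : y + Y' ρ / ρ - Y ρ / ρ ^ 2
      - mu / (lam + 2 * mu) * κ ^ 2 * Y ρ + (lam + mu) / (lam + 2 * mu) * κ * Z' ρ = 0)
    (e₂ : z + Z' ρ / ρ - (lam + 2 * mu) / mu * κ ^ 2 * Z ρ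
      - (lam + mu) / mu * κ * (Y' ρ + Y ρ / ρ) = -(1 / mu) * g) :
    SolvesRadialSystemAt lam mu κ g Y Z ρ := by
  have dY : deriv Y =ᶠ[nhds ρ] Y' := hY.mono fun r hr => hr.deriv
  have dZ : deriv Z =ᶠ[nhds ρ] Z' := hZ.mono fun r hr => hr.deriv
  have hY'' := hY'.congr_of_eventuallyEq dY
  have hZ'' := hZ'.congr_of_eventuallyEq dZ
  refine ⟨hY.mono fun r hr => hr.differentiableAt, hZ.mono fun r hr => hr.differentiableAt,
    hY''.differentiableAt, hZ''.differentiableAt, ?_, ?_⟩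
  · rw [hY''.deriv, dY.self_of_nhds, dZ.self_of_nhds, e₁]
  · rw [hZ''.deriv, dY.self_of_nhds, dZ.self_of_nhds, e₂]

theorem continuousOn_sysMatrix (lam mu κ : ℝ) : ContinuousOn (sysMatrix lam mu κ) (Ioi 0) := by
  refine continuousOn_pi.2 fun i => continuousOn_pi.2 fun j => ?_
  have h : ∀ x ∈ Ioi (0 : ℝ), x ≠ 0 := fun x hx => ne_of_gt hx
  have h2 : ∀ x ∈ Ioi (0 : ℝ), x ^ 2 ≠ 0 := fun x hx => pow_ne_zero 2 (h x hx)
  fin_cases i <;> fin_cases j <;> simp [sysMatrix] <;> fun_prop (disch := assumption)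

/-- On a compact interval of positive radii the matrices have bounded operator norm, so the
right-hand side is uniformly Lipschitz, and ODE uniqueness applies to `u` and the zero solution. -/
theorem eq_zero_of_linear_ode {ι : Type*} [Fintype ι] [DecidableEq ι]
    {A : ℝ → Matrix ι ι ℝ} (hA : ContinuousOn A (Ioi 0)) {u : ℝ → ι → ℝ}
    (hu : ∀ ρ, 0 < ρ → HasDerivAt u ((A ρ).mulVec (u ρ)) ρ) {ρ₀ : ℝ} (hρ₀ : 0 < ρ₀)
    (h0 : u ρ₀ = 0) : ∀ ρ, 0 < ρ → u ρ = 0 := by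
  intro ρ hρ
  -- The interval has both radii in its interior and stays away from the singularity at `0`.
  set l := min ρ₀ ρ / 2 with hl
  set r := max ρ₀ ρ + 1 with hr
  have hmin : 0 < min ρ₀ ρ := lt_min hρ₀ hρ
  have hl0 : 0 < l := by positivity
  have m1 : min ρ₀ ρ ≤ ρ₀ := min_le_left _ _
  have m2 : min ρ₀ ρ ≤ ρ := min_le_right _ _
  have m3 : ρ₀ ≤ max ρ₀ ρ := le_max_left _ _
  have m4 : ρ ≤ max ρ₀ ρ := le_max_right _ _
  let T : Matrix ι ι ℝ →ₗ[ℝ] ((ι → ℝ) →L[ℝ] (ι → ℝ)) :=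
    (LinearMap.toContinuousLinearMap : ((ι → ℝ) →ₗ[ℝ] (ι → ℝ)) ≃ₗ[ℝ] _).toLinearMap ∘ₗ
      (Matrix.toLin' : Matrix ι ι ℝ ≃ₗ[ℝ] _).toLinearMap
  have hT : ∀ M v, T M v = M.mulVec v := fun M v => by simp [T]
  have hTc : ContinuousOn (fun t => T (A t)) (Icc l r) :=
    (LinearMap.continuous_of_finiteDimensional T).comp_continuousOn
      (hA.mono fun x hx => lt_of_lt_of_le hl0 hx.1)
  obtain ⟨C, hC⟩ := isCompact_Icc.exists_bound_of_continuousOn hTc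
  have key := ODE_solution_unique_of_mem_Ioo (K := C.toNNReal) (s := fun _ => univ)
    (v := fun t x => (A t).mulVec x) (f := u) (g := fun _ => 0) (a := l) (b := r) (t₀ := ρ₀)
    (fun t ht => by
      refine LipschitzWith.lipschitzOnWith ?_
      have h1 := (T (A t)).lipschitz
      have h2 : (fun x => (A t).mulVec x) = T (A t) := funext fun v => (hT _ v).symm
      rw [h2]
      refine h1.weaken ?_
      rw [← NNReal.coe_le_coe, coe_nnnorm]
      exact (hC t (Ioo_subset_Icc_self ht)).trans (Real.le_coe_toNNReal C))
    ⟨by linarith, by linarith⟩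
    (fun t ht => ⟨hu t (hl0.trans ht.1), trivial⟩)
    (fun t _ => ⟨by simpa using hasDerivAt_const t (0 : ι → ℝ), trivial⟩) h0
  exact key ⟨by linarith, by linarith⟩

theorem IsHomogeneousSolution.hasDerivAt_state {lam mu κ : ℝ} {Y Z : ℝ → ℝ}
    (h : IsHomogeneousSolution lam mu κ Y Z) {ρ : ℝ} (hρ : 0 < ρ) :
    HasDerivAt (state Y Z) ((sysMatrix lam mu κ ρ).mulVec (state Y Z ρ)) ρ := by
  have := (h ρ hρ).hasDerivAt_state
  have e : (![0, 0, 0, -(1 / mu) * 0] : Fin 4 → ℝ) = 0 := by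
    ext i; fin_cases i <;> simp
  rwa [e, add_zero] at this

/-! ### Wronskian and fundamental systems -/

theorem wronskian_mulVec (Y Z : Fin 4 → ℝ → ℝ) (ρ : ℝ) (C : Fin 4 → ℝ) :
    (wronskian Y Z ρ).mulVec C = ∑ j, C j • state (Y j) (Z j) ρ := by
  ext i
  simp only [Matrix.mulVec, dotProduct, wronskian_apply, Finset.sum_apply, Pi.smul_apply,
    smul_eq_mul, mul_comm]

theorem hasDerivAt_wronskian_mulVec {lam mu κ : ℝ} {Y Z : Fin 4 → ℝ → ℝ}
    (h : ∀ j, IsHomogeneousSolution lam mu κ (Y j) (Z j)) (C : Fin 4 → ℝ) {ρ : ℝ} (hρ : 0 < ρ) :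
    HasDerivAt (fun r => (wronskian Y Z r).mulVec C)
      ((sysMatrix lam mu κ ρ).mulVec ((wronskian Y Z ρ).mulVec C)) ρ := by
  simp only [wronskian_mulVec]
  have := HasDerivAt.fun_sum (u := Finset.univ) fun j _ =>
    ((h j).hasDerivAt_state hρ).const_smul (C j)
  convert! this using 1
  simp only [Matrix.mulVec_sum, Matrix.mulVec_smul]

theorem combination_eq_zero_of_wronskian {lam mu κ : ℝ} {Y Z : Fin 4 → ℝ → ℝ}
    (h : ∀ j, IsHomogeneousSolution lam mu κ (Y j) (Z j)) {C : Fin 4 → ℝ} {ρ₀ : ℝ} (hρ₀ : 0 < ρ₀)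
    (h0 : (wronskian Y Z ρ₀).mulVec C = 0) {ρ : ℝ} (hρ : 0 < ρ) :
    (wronskian Y Z ρ).mulVec C = 0 :=
  eq_zero_of_linear_ode (continuousOn_sysMatrix lam mu κ)
    (fun _ hr => hasDerivAt_wronskian_mulVec h C hr) hρ₀ h0 ρ hρ

/-- A kernel vector of the Wronskian at a single radius is a combination with zero Cauchy data
there, hence a linear relation on all of `(0, ∞)`. -/
theorem IsFundamentalSystem.eq_zero {lam mu κ : ℝ} {Y Z : Fin 4 → ℝ → ℝ}
    (h : IsFundamentalSystem lam mu κ Y Z) {C : Fin 4 → ℝ} {ρ₀ : ℝ} (hρ₀ : 0 < ρ₀)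
    (h0 : (wronskian Y Z ρ₀).mulVec C = 0) : C = 0 := by
  have := Fintype.linearIndependent_iff.1 h.linearIndependent C (by
    ext ρ
    · have := congrFun (combination_eq_zero_of_wronskian h.solves hρ₀ h0 ρ.2) 0
      rw [wronskian_mulVec] at this
      simpa [state, Prod.fst_sum] using this
    · have := congrFun (combination_eq_zero_of_wronskian h.solves hρ₀ h0 ρ.2) 2
      rw [wronskian_mulVec] at this
      simpa [state, Prod.snd_sum] using this)
  exact funext this

theorem IsFundamentalSystem.isUnit_det {lam mu κ : ℝ} {Y Z : Fin 4 → ℝ → ℝ}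
    (h : IsFundamentalSystem lam mu κ Y Z) {ρ : ℝ} (hρ : 0 < ρ) :
    IsUnit (wronskian Y Z ρ).det := by
  rw [isUnit_iff_ne_zero]
  intro hdet
  obtain ⟨v, hv, hv0⟩ := Matrix.exists_mulVec_eq_zero_iff.2 hdet
  exact hv (h.eq_zero hρ hv0)

/-- The constants match the Cauchy data at radius `1`; the difference solves the linear system and
vanishes there. -/
theorem IsFundamentalSystem.exists_combination {lam mu κ : ℝ} {Y Z : Fin 4 → ℝ → ℝ}
    (h : IsFundamentalSystem lam mu κ Y Z) {Y₁ Z₁ : ℝ → ℝ}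
    (h₁ : IsHomogeneousSolution lam mu κ Y₁ Z₁) :
    ∃ C : Fin 4 → ℝ, ∀ ρ, 0 < ρ → Y₁ ρ = ∑ j, C j * Y j ρ ∧ Z₁ ρ = ∑ j, C j * Z j ρ := by
  refine ⟨(wronskian Y Z 1)⁻¹.mulVec (state Y₁ Z₁ 1), fun ρ hρ => ?_⟩
  set C := (wronskian Y Z 1)⁻¹.mulVec (state Y₁ Z₁ 1) with hC
  have h0 := eq_zero_of_linear_ode (continuousOn_sysMatrix lam mu κ)
    (u := fun r => state Y₁ Z₁ r - (wronskian Y Z r).mulVec C) (fun r hr => by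
      rw [Matrix.mulVec_sub]
      exact (h₁.hasDerivAt_state hr).sub (hasDerivAt_wronskian_mulVec h.solves C hr))
    one_pos (by
      rw [hC, Matrix.mulVec_mulVec, Matrix.mul_nonsing_inv _ (h.isUnit_det one_pos),
        Matrix.one_mulVec, sub_self]) ρ hρ
  simp only [sub_eq_zero, wronskian_mulVec] at h0
  exact ⟨by simpa [state] using congrFun h0 0, by simpa [state] using congrFun h0 2⟩

/-! ### Variation of constants -/

/-- Countably many exceptional points do not prevent `f` from being a primitive of the continuous
`g`, and such a primitive is differentiable at the exceptional points too. This carries the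
derivative formulas across the jumps of the load. -/
theorem hasDerivAt_of_hasDerivAt_off_countable {f g : ℝ → ℝ} {s : Set ℝ} (hs : s.Countable)
    (hf : ContinuousOn f (Ioi 0)) (hg : ContinuousOn g (Ioi 0))
    (h : ∀ x, 0 < x → x ∉ s → HasDerivAt f (g x) x) {x : ℝ} (hx : 0 < x) :
    HasDerivAt f (g x) x := by
  have hsub : ∀ y, 0 < y → uIcc x y ⊆ Ioi 0 := fun y hy t ht =>
    lt_of_lt_of_le (lt_min hx hy) ht.1
  have hftc : ∀ y, 0 < y → ∫ t in x..y, g t = f y - f x := fun y hy =>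
    integral_eq_of_hasDerivAt_off_countable f g hs (hf.mono (hsub y hy))
      (fun t ht => h t (hsub y hy (Ioo_subset_Icc_self ht.1)) ht.2)
      (hg.mono (hsub y hy)).intervalIntegrable
  have hgx : ContinuousAt g x := hg.continuousAt (Ioi_mem_nhds hx)
  have h1 : HasDerivAt (fun y => ∫ t in x..y, g t) (g x) x :=
    intervalIntegral.integral_hasDerivAt_right (by simp)
      (hg.stronglyMeasurableAtFilter isOpen_Ioi x hx) hgx
  have h2 := h1.const_add (f x)
  refine h2.congr_of_eventuallyEq ?_
  filter_upwards [Ioi_mem_nhds hx] with y hy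
  rw [hftc y hy]; ring

theorem continuousOn_wronskian {lam mu κ : ℝ} {Y Z : Fin 4 → ℝ → ℝ}
    (h : ∀ j, IsHomogeneousSolution lam mu κ (Y j) (Z j)) :
    ContinuousOn (wronskian Y Z) (Ioi 0) := by
  refine continuousOn_pi.2 fun i => continuousOn_pi.2 fun j => ?_
  exact fun ρ hρ => ((hasDerivAt_pi.1 ((h j).hasDerivAt_state hρ) i).continuousAt).continuousWithinAt

/-- Cramer's rule: the adjugate is polynomial in the entries and the determinant does not vanish. -/
theorem IsFundamentalSystem.continuousOn_inv_mulVec {lam mu κ : ℝ} {Y Z : Fin 4 → ℝ → ℝ}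
    (h : IsFundamentalSystem lam mu κ Y Z) (v : Fin 4 → ℝ) :
    ContinuousOn (fun r => (wronskian Y Z r)⁻¹.mulVec v) (Ioi 0) := by
  have hW := continuousOn_wronskian h.solves
  have hdet : ContinuousOn (fun r => (wronskian Y Z r).det) (Ioi 0) :=
    (continuous_id.matrix_det).comp_continuousOn hW
  have hadj : ContinuousOn (fun r => (wronskian Y Z r).adjugate.mulVec v) (Ioi 0) :=
    ((continuous_id.matrix_adjugate).matrix_mulVec continuous_const).comp_continuousOn hW
  have : ContinuousOn (fun r => (wronskian Y Z r).det⁻¹ • (wronskian Y Z r).adjugate.mulVec v)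
      (Ioi 0) := (hdet.inv₀ fun r hr => (h.isUnit_det hr).ne_zero).smul hadj
  refine this.congr fun r _ => ?_
  simp only [Matrix.inv_def, Ring.inverse_eq_inv', Matrix.smul_mulVec]

theorem variationIntegrand_eq_smul (mu : ℝ) (g : ℝ → ℝ) (Y Z : Fin 4 → ℝ → ℝ) (r : ℝ) :
    variationIntegrand mu g Y Z r =
      g r • (wronskian Y Z r)⁻¹.mulVec ![0, 0, 0, -(1 / mu)] := by
  rw [variationIntegrand, ← Matrix.mulVec_smul]
  congr 1
  ext i; fin_cases i <;> simp [mul_comm]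

theorem IsFundamentalSystem.intervalIntegrable_variationIntegrand {lam mu κ : ℝ}
    {Y Z : Fin 4 → ℝ → ℝ} (h : IsFundamentalSystem lam mu κ Y Z) {g : ℝ → ℝ}
    (hg : ∀ x y, IntervalIntegrable g volume x y) {x y : ℝ} (hx : 0 < x) (hy : 0 < y) :
    IntervalIntegrable (variationIntegrand mu g Y Z) volume x y := by
  rw [funext (variationIntegrand_eq_smul mu g Y Z)]
  exact (hg x y).smul_continuousOn ((h.continuousOn_inv_mulVec _).mono fun t ht =>
    lt_of_lt_of_le (lt_min hx hy) ht.1)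

theorem IsFundamentalSystem.continuousOn_particular {lam mu κ : ℝ} {Y Z : Fin 4 → ℝ → ℝ}
    (h : IsFundamentalSystem lam mu κ Y Z) {g : ℝ → ℝ}
    (hg : ∀ x y, IntervalIntegrable g volume x y) {a : ℝ} (ha : 0 < a) :
    ContinuousOn (particular a mu g Y Z) (Ioi 0) := by
  have hV : ContinuousOn (fun ρ => ∫ r in a..ρ, variationIntegrand mu g Y Z r) (Ioi 0) := by
    intro ρ hρ
    have hρ' : 0 < ρ := hρ
    have hmin : 0 < min a ρ := lt_min ha hρ
    have m1 : min a ρ ≤ a := min_le_left _ _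
    have m2 : min a ρ ≤ ρ := min_le_right _ _
    have m3 : a ≤ max a ρ := le_max_left _ _
    have m4 : ρ ≤ max a ρ := le_max_right _ _
    have hle : min a ρ / 2 ≤ max a ρ + 1 := by linarith
    have hc := intervalIntegral.continuousOn_primitive_interval' (a := a)
      (h.intervalIntegrable_variationIntegrand hg (x := min a ρ / 2) (y := max a ρ + 1)
        (by positivity) (by linarith))
      (by rw [uIcc_of_le hle]; constructor <;> linarith)
    rw [uIcc_of_le hle] at hc
    exact (hc.continuousAt (Icc_mem_nhds (by linarith) (by linarith))).continuousWithinAt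
  have hW := continuousOn_wronskian h.solves
  have : Continuous fun p : Matrix (Fin 4) (Fin 4) ℝ × (Fin 4 → ℝ) => p.1.mulVec p.2 :=
    continuous_fst.matrix_mulVec continuous_snd
  exact this.comp_continuousOn (hW.prodMk hV)

/-- In the product rule for `W V`, the term `W' V` reproduces the system matrix, and in `W V'` the
factor `W` cancels the inverse in the integrand. -/
theorem IsFundamentalSystem.hasDerivAt_particular {lam mu κ : ℝ} {Y Z : Fin 4 → ℝ → ℝ}
    (h : IsFundamentalSystem lam mu κ Y Z) {g : ℝ → ℝ} (hgm : Measurable g)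
    (hg : ∀ x y, IntervalIntegrable g volume x y) {a ρ : ℝ} (ha : 0 < a) (hρ : 0 < ρ)
    (hgρ : ContinuousAt g ρ) :
    HasDerivAt (particular a mu g Y Z)
      ((sysMatrix lam mu κ ρ).mulVec (particular a mu g Y Z ρ) +
        ![0, 0, 0, -(1 / mu) * g ρ]) ρ := by
  have hMc := h.continuousOn_inv_mulVec ![0, 0, 0, -(1 / mu)]
  have hV : HasDerivAt (fun ρ => ∫ r in a..ρ, variationIntegrand mu g Y Z r)
      (variationIntegrand mu g Y Z ρ) ρ := by
    refine intervalIntegral.integral_hasDerivAt_right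
      (h.intervalIntegrable_variationIntegrand hg ha hρ) ?_ ?_
    · rw [funext (variationIntegrand_eq_smul mu g Y Z)]
      exact ⟨Ioi 0, Ioi_mem_nhds hρ, hgm.aestronglyMeasurable.smul
        (hMc.aestronglyMeasurable measurableSet_Ioi)⟩
    · rw [funext (variationIntegrand_eq_smul mu g Y Z)]
      exact hgρ.smul (hMc.continuousAt (Ioi_mem_nhds hρ))
  set V := fun ρ => ∫ r in a..ρ, variationIntegrand mu g Y Z r with hVdef
  have hP : ∀ r, particular a mu g Y Z r = ∑ j, V r j • state (Y j) (Z j) r := fun r => by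
    rw [← wronskian_mulVec]; rfl
  have hd := HasDerivAt.fun_sum (u := Finset.univ) fun j _ =>
    (hasDerivAt_pi.1 hV j).fun_smul ((h.solves j).hasDerivAt_state hρ)
  rw [funext hP]
  convert! hd using 1
  simp only [Finset.sum_add_distrib, Matrix.mulVec_sum, Matrix.mulVec_smul]
  congr 1
  rw [← wronskian_mulVec, variationIntegrand, Matrix.mulVec_mulVec,
    Matrix.mul_nonsing_inv _ (h.isUnit_det hρ), Matrix.one_mulVec]

/-- The load enters only the last row, so the derivatives of components `0` and `2` are the
continuous components `1` and `3`, even where the load jumps. -/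
theorem IsFundamentalSystem.hasDerivAt_particular_fst {lam mu κ : ℝ} {Y Z : Fin 4 → ℝ → ℝ}
    (h : IsFundamentalSystem lam mu κ Y Z) {g : ℝ → ℝ} (hgm : Measurable g)
    (hg : ∀ x y, IntervalIntegrable g volume x y) {s : Set ℝ} (hs : s.Countable)
    (hgs : ∀ x, x ∉ s → ContinuousAt g x) {a ρ : ℝ} (ha : 0 < a) (hρ : 0 < ρ) :
    HasDerivAt (fun r => particular a mu g Y Z r 0) (particular a mu g Y Z ρ 1) ρ ∧
      HasDerivAt (fun r => particular a mu g Y Z r 2) (particular a mu g Y Z ρ 3) ρ := by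
  have hc := continuousOn_pi.1 (h.continuousOn_particular (mu := mu) hg ha)
  constructor
  · refine hasDerivAt_of_hasDerivAt_off_countable hs (hc 0) (hc 1) (fun x hx hxs => ?_) hρ
    have := hasDerivAt_pi.1 (h.hasDerivAt_particular hgm hg ha hx (hgs x hxs)) 0
    simpa [sysMatrix, Matrix.vecHead, Matrix.vecTail] using this
  · refine hasDerivAt_of_hasDerivAt_off_countable hs (hc 2) (hc 3) (fun x hx hxs => ?_) hρ
    have := hasDerivAt_pi.1 (h.hasDerivAt_particular hgm hg ha hx (hgs x hxs)) 2
    simpa [sysMatrix, Matrix.vecHead, Matrix.vecTail] using this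

theorem IsFundamentalSystem.solvesRadialSystemAt_particular {lam mu κ : ℝ} {Y Z : Fin 4 → ℝ → ℝ}
    (h : IsFundamentalSystem lam mu κ Y Z) {g : ℝ → ℝ} (hgm : Measurable g)
    (hg : ∀ x y, IntervalIntegrable g volume x y) {s : Set ℝ} (hs : s.Countable)
    (hgs : ∀ x, x ∉ s → ContinuousAt g x) {a ρ : ℝ} (ha : 0 < a) (hρ : 0 < ρ) (hρs : ρ ∉ s) :
    SolvesRadialSystemAt lam mu κ (g ρ) (fun r => particular a mu g Y Z r 0)
      (fun r => particular a mu g Y Z r 2) ρ := by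
  have hd := hasDerivAt_pi.1 (h.hasDerivAt_particular hgm hg ha hρ (hgs ρ hρs))
  have hf : ∀ᶠ r in nhds ρ, 0 < r := Ioi_mem_nhds hρ
  refine SolvesRadialSystemAt.of_hasDerivAt
    (hf.mono fun r hr => (h.hasDerivAt_particular_fst hgm hg hs hgs ha hr).1)
    (hf.mono fun r hr => (h.hasDerivAt_particular_fst hgm hg hs hgs ha hr).2)
    (hd 1) (hd 3) ?_ ?_
  · simp [sysMatrix, dotProduct, Fin.sum_univ_four]
    ring
  · simp [sysMatrix, dotProduct, Fin.sum_univ_four]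
    ring

/-! ### Regularity of the load -/

theorem measurable_Psi (a ε h p : ℝ) (k : ℕ) : Measurable (Psi a ε h p k) := by
  have hl : Measurable (load a ε p) :=
    Measurable.ite measurableSet_Ioo measurable_const measurable_const
  unfold Psi
  split_ifs
  · exact hl.const_mul _
  · exact measurable_const

theorem norm_Psi_le (a ε h p : ℝ) (k : ℕ) (ρ : ℝ) : ‖Psi a ε h p k ρ‖ ≤ |4 / h| * |p| := by
  unfold Psi load
  split_ifs <;> simp [abs_div] <;> positivity

theorem intervalIntegrable_Psi (a ε h p : ℝ) (k : ℕ) (x y : ℝ) :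
    IntervalIntegrable (Psi a ε h p k) volume x y := by
  refine (intervalIntegrable_const (c := |4 / h| * |p|)).mono_fun
    (measurable_Psi a ε h p k).aestronglyMeasurable (ae_of_all _ fun r => ?_)
  exact (norm_Psi_le a ε h p k r).trans (le_abs_self _)

theorem continuousAt_Psi (a ε h p : ℝ) (k : ℕ) {x : ℝ} (hx : x ∉ ({a, ε} : Set ℝ)) :
    ContinuousAt (Psi a ε h p k) x := by
  simp only [mem_insert_iff, mem_singleton_iff, not_or] at hx
  have hl : ContinuousAt (load a ε p) x := by
    rcases lt_or_gt_of_ne hx.1 with h1 | h1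
    · refine (continuousAt_const (y := (0 : ℝ))).congr ?_
      filter_upwards [Iio_mem_nhds h1] with y hy
      rw [load, if_neg fun hc => (lt_asymm hy hc.1)]
    · rcases lt_or_gt_of_ne hx.2 with h2 | h2
      · refine (continuousAt_const (y := p)).congr ?_
        filter_upwards [Ioo_mem_nhds h1 h2] with y hy
        rw [load, if_pos ⟨hy.1, hy.2⟩]
      · refine (continuousAt_const (y := (0 : ℝ))).congr ?_
        filter_upwards [Ioi_mem_nhds h2] with y hy
        rw [load, if_neg fun hc => (lt_asymm hy hc.2)]
  unfold Psi
  split_ifs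
  · exact continuousAt_const.mul hl
  · exact continuousAt_const

/-! ### Weak derivatives and integration by parts -/

theorem integral_primitive_mul {a b : ℝ} {f g : ℝ → ℝ}
    (hf : IntervalIntegrable f volume a b) (hg : IntervalIntegrable g volume a b) :
    ∫ x in a..b, (∫ t in a..x, f t) * g x =
      (∫ x in a..b, f x) * (∫ x in a..b, g x) - ∫ x in a..b, f x * ∫ t in a..x, g t := by
  have h := (hf.absolutelyContinuousOnInterval_intervalIntegral
    (c := a) (by simp)).integral_mul_deriv_eq_deriv_mul
    (hg.absolutelyContinuousOnInterval_intervalIntegral (c := a) (by simp))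
  simp only [intervalIntegral.integral_same, mul_zero, sub_zero] at h
  rw [intervalIntegral.integral_congr_ae (g := fun x => (∫ t in a..x, f t) *
      deriv (fun x => ∫ t in a..x, g t) x), h]
  · congr 1
    refine intervalIntegral.integral_congr_ae ?_
    filter_upwards [hf.ae_hasDerivAt_integral] with x hx hxm
    rw [(hx (uIoc_subset_uIcc hxm) a (by simp)).deriv]
  · filter_upwards [hg.ae_hasDerivAt_integral] with x hx hxm
    rw [(hx (uIoc_subset_uIcc hxm) a (by simp)).deriv]

/-- The du Bois-Reymond lemma. Subtracting from a test function its integral times a fixed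
normalized bump leaves mean zero, hence the derivative of another test function; so `w` minus its
average against the bump annihilates all test functions. -/
theorem ae_const_of_integral_mul_deriv_eq_zero {a b : ℝ} (hab : a < b) {w : ℝ → ℝ}
    (hw : IntegrableOn w (Ioo a b))
    (h : ∀ φ : ℝ → ℝ, ContDiff ℝ (⊤ : ℕ∞) φ → HasCompactSupport φ → tsupport φ ⊆ Ioo a b →
      ∫ x in Ioo a b, w x * deriv φ x = 0) :
    ∃ c : ℝ, ∀ᵐ x ∂(volume.restrict (Ioo a b)), w x = c := by
  let B : ContDiffBump ((a + b) / 2) :=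
    ⟨(b - a) / 8, (b - a) / 4, by linarith, by linarith⟩
  set ψ₀ : ℝ → ℝ := B.normed volume with hψ₀
  have hψ₀s : ContDiff ℝ (⊤ : ℕ∞) ψ₀ := B.contDiff_normed
  have hψ₀c : HasCompactSupport ψ₀ := B.hasCompactSupport_normed
  have hψ₀t : tsupport ψ₀ ⊆ Ioo a b := by
    rw [hψ₀, B.tsupport_normed_eq, Real.closedBall_eq_Icc]
    intro x hx
    have h1 : (a + b) / 2 - (b - a) / 4 ≤ x := hx.1
    have h2 : x ≤ (a + b) / 2 + (b - a) / 4 := hx.2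
    constructor <;> linarith
  have hψ₀i : ∫ x, ψ₀ x = 1 := B.integral_normed
  have hne : (tsupport ψ₀).Nonempty := by
    rw [hψ₀, B.tsupport_normed_eq, Real.closedBall_eq_Icc]
    exact ⟨(a + b) / 2, by constructor <;> show _ ≤ _ <;> change (_ : ℝ) ≤ _ <;>
      simp [B] <;> linarith⟩
  have hwmul : ∀ ψ : ℝ → ℝ, Continuous ψ → HasCompactSupport ψ →
      IntegrableOn (fun x => w x * ψ x) (Ioo a b) := by
    intro ψ hψ hψc
    obtain ⟨C, hC⟩ := hψ.bounded_above_of_compact_support hψc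
    exact Integrable.mul_bdd hw hψ.aestronglyMeasurable (ae_of_all _ hC)
  refine ⟨∫ x in Ioo a b, w x * ψ₀ x, ?_⟩
  set c := ∫ x in Ioo a b, w x * ψ₀ x with hc
  have hint : IntegrableOn (fun x => w x - c) (Ioo a b) :=
    hw.sub (integrableOn_const (by simp))
  have := isOpen_Ioo.ae_eq_zero_of_integral_contDiff_smul_eq_zero (μ := volume)
    hint.locallyIntegrableOn ?_
  · rw [ae_restrict_iff' measurableSet_Ioo]
    filter_upwards [this] with x hx hxm
    linarith [hx hxm]
  intro ψ hψs hψc hψt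
  set m := ∫ x, ψ x with hm
  set χ : ℝ → ℝ := fun x => ψ x - m * ψ₀ x with hχ
  have hχs : ContDiff ℝ (⊤ : ℕ∞) χ := hψs.sub (contDiff_const.mul hψ₀s)
  have hχcont : Continuous χ := hχs.continuous
  have hψi : Integrable ψ := hψs.continuous.integrable_of_hasCompactSupport hψc
  have hψ₀int : Integrable ψ₀ := hψ₀s.continuous.integrable_of_hasCompactSupport hψ₀c
  have hχ0 : ∫ x, χ x = 0 := by
    rw [hχ, integral_sub hψi (hψ₀int.const_mul m), integral_const_mul, hψ₀i]
    simp [hm]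
  set K := tsupport ψ ∪ tsupport ψ₀ with hK
  have hKc : IsCompact K := hψc.isCompact.union hψ₀c.isCompact
  have hKne : K.Nonempty := hne.mono subset_union_right
  have hKs : K ⊆ Ioo a b := union_subset hψt hψ₀t
  set l := sInf K
  set r := sSup K
  have hl : l ∈ Ioo a b := hKs (hKc.sInf_mem hKne)
  have hr : r ∈ Ioo a b := hKs (hKc.sSup_mem hKne)
  have hχz : ∀ x, x ∉ Icc l r → χ x = 0 := by
    intro x hx
    have hxK : x ∉ K := fun hxK =>
      hx ⟨csInf_le hKc.bddBelow hxK, le_csSup hKc.bddAbove hxK⟩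
    have h1 : ψ x = 0 := image_eq_zero_of_notMem_tsupport fun h => hxK (Or.inl h)
    have h2 : ψ₀ x = 0 := image_eq_zero_of_notMem_tsupport fun h => hxK (Or.inr h)
    simp [hχ, h1, h2]
  -- Because `χ` has integral zero, its primitive vanishes to the right of `[l, r]` as well as to
  -- the left.
  set φ : ℝ → ℝ := fun x => ∫ t in a..x, χ t with hφ
  have hφd : ∀ x, HasDerivAt φ (χ x) x := fun x =>
    hχcont.integral_hasStrictDerivAt a x |>.hasDerivAt
  have hφderiv : deriv φ = χ := funext fun x => (hφd x).deriv
  have hφs : ContDiff ℝ (⊤ : ℕ∞) φ := by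
    rw [contDiff_infty_iff_deriv]
    exact ⟨fun x => (hφd x).differentiableAt, hφderiv ▸ hχs⟩
  have hφz : ∀ x, x ∉ Icc l r → φ x = 0 := by
    intro x hx
    rcases lt_or_ge x l with hxl | hxl
    · simp only [hφ]
      rw [intervalIntegral.integral_zero_ae]
      refine ae_of_all _ fun t ht => hχz t fun ht' => ?_
      rcases le_total a x with hax | hax
      · rw [uIoc_of_le hax] at ht; linarith [ht.2, ht'.1]
      · rw [uIoc_of_ge hax] at ht; linarith [ht.2, ht'.1, hl.1]
    · have hxr : r < x := by
        by_contra hcon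
        exact hx ⟨hxl, not_lt.mp hcon⟩
      have hax : a ≤ x := by linarith [hr.1]
      simp only [hφ]
      rw [intervalIntegral.integral_of_le hax,
        setIntegral_eq_integral_of_forall_compl_eq_zero, hχ0]
      intro t ht
      refine hχz t fun ht' => ht ⟨by linarith [hl.1, ht'.1], by linarith [ht'.2]⟩
  have hφt : tsupport φ ⊆ Icc l r := by
    refine closure_minimal ?_ isClosed_Icc
    intro x hx
    by_contra hcon
    exact hx (hφz x hcon)
  have hφc : HasCompactSupport φ := isCompact_Icc.of_isClosed_subset (isClosed_tsupport _) hφt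
  have key := h φ hφs hφc (hφt.trans fun x hx => ⟨lt_of_lt_of_le hl.1 hx.1, lt_of_le_of_lt hx.2 hr.2⟩)
  rw [hφderiv] at key
  have e1 : ∫ x in Ioo a b, w x * χ x =
      (∫ x in Ioo a b, w x * ψ x) - m * c := by
    rw [hc, ← integral_const_mul, ← integral_sub (hwmul ψ hψs.continuous hψc)
      ((hwmul ψ₀ hψ₀s.continuous hψ₀c).const_mul m)]
    refine integral_congr_ae (ae_of_all _ fun x => ?_)
    simp only [hχ]; ring
  have hψIoo : ∫ x in Ioo a b, ψ x = m :=
    setIntegral_eq_integral_of_forall_compl_eq_zero fun x hx =>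
      image_eq_zero_of_notMem_tsupport fun h => hx (hψt h)
  rw [← setIntegral_eq_integral_of_forall_compl_eq_zero (s := Ioo a b)]
  · have e2 : ∫ x in Ioo a b, ψ x • (w x - c) =
        (∫ x in Ioo a b, w x * ψ x) - c * ∫ x in Ioo a b, ψ x := by
      rw [← integral_const_mul, ← integral_sub (hwmul ψ hψs.continuous hψc)
        (hψi.integrableOn.const_mul c)]
      refine integral_congr_ae (ae_of_all _ fun x => ?_)
      simp only [smul_eq_mul]; ring
    rw [e2, hψIoo]
    linarith [e1, key]
  · intro x hx
    have : ψ x = 0 := image_eq_zero_of_notMem_tsupport fun h => hx (hψt h)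
    simp [this]

/-- Enlarges the test class to absolutely continuous functions vanishing at both ends. By du
Bois-Reymond, `u` is a primitive of `v` plus a constant; the constant disappears because `f` has
integral zero. -/
theorem HasWeakDerivOn.integral_primitive_mul {a b : ℝ} (hab : a < b) {u v f : ℝ → ℝ}
    (h : HasWeakDerivOn a b u v) (hu : IntegrableOn u (Ioo a b)) (hv : IntegrableOn v (Ioo a b))
    (hf : IntegrableOn f (Ioo a b)) (hf0 : ∫ x in a..b, f x = 0) :
    ∫ x in Ioo a b, (∫ t in a..x, f t) * v x = -∫ x in Ioo a b, f x * u x := by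
  have conv : ∀ g : ℝ → ℝ, ∫ x in Ioo a b, g x = ∫ x in a..b, g x := fun g => by
    rw [intervalIntegral.integral_of_le hab.le, integral_Ioc_eq_integral_Ioo]
  have convI : ∀ g : ℝ → ℝ, IntegrableOn g (Ioo a b) → IntervalIntegrable g volume a b :=
    fun g hg => (intervalIntegrable_iff_integrableOn_Ioo_of_le hab.le).2 hg
  have convI' : ∀ g : ℝ → ℝ, IntervalIntegrable g volume a b → IntegrableOn g (Ioo a b) :=
    fun g hg => (intervalIntegrable_iff_integrableOn_Ioo_of_le hab.le).1 hg
  have hvi := convI v hv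
  have hfi := convI f hf
  have hVc : ContinuousOn (fun x => ∫ t in a..x, v t) (uIcc a b) :=
    intervalIntegral.continuousOn_primitive_interval' hvi (by simp)
  have hVi : IntegrableOn (fun x => ∫ t in a..x, v t) (Ioo a b) :=
    convI' _ hVc.intervalIntegrable
  obtain ⟨c, hc⟩ := ae_const_of_integral_mul_deriv_eq_zero hab
    (w := fun x => u x - ∫ t in a..x, v t) (hu.sub hVi) (by
      intro φ hφs hφc hφt
      have hd : Continuous (deriv φ) := hφs.continuous_deriv (by simp)
      have hdi : IntervalIntegrable (deriv φ) volume a b := hd.intervalIntegrable _ _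
      have hφ0 : ∀ x, x ∉ Ioo a b → φ x = 0 := fun x hx =>
        image_eq_zero_of_notMem_tsupport fun h => hx (hφt h)
      have hdφ : ∀ x, ∫ t in a..x, deriv φ t = φ x := fun x => by
        rw [intervalIntegral.integral_deriv_eq_sub
          (fun t _ => (hφs.differentiable (by simp)).differentiableAt)
          (hd.intervalIntegrable _ _), hφ0 a (by simp), sub_zero]
      have h1 := HollowCylinder.integral_primitive_mul hvi hdi
      simp only [hdφ, hφ0 b (by simp), mul_zero, zero_sub] at h1
      obtain ⟨C, hC⟩ := hd.bounded_above_of_compact_support hφc.deriv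
      have i1 : IntegrableOn (fun x => u x * deriv φ x) (Ioo a b) :=
        Integrable.mul_bdd hu hd.aestronglyMeasurable (ae_of_all _ hC)
      have i2 : IntegrableOn (fun x => (∫ t in a..x, v t) * deriv φ x) (Ioo a b) :=
        Integrable.mul_bdd hVi hd.aestronglyMeasurable (ae_of_all _ hC)
      simp only [sub_mul]
      rw [integral_sub i1 i2, h φ hφs hφc hφt, conv (fun x => v x * φ x), conv, h1, sub_self])
  have h2 := HollowCylinder.integral_primitive_mul hfi hvi
  rw [hf0, zero_mul, zero_sub] at h2
  rw [conv, h2, ← conv]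
  congr 1
  have i3 : IntegrableOn (fun x => f x * ∫ t in a..x, v t) (Ioo a b) :=
    convI' _ (hfi.mul_continuousOn hVc)
  have e : ∫ x in Ioo a b, f x * u x = ∫ x in Ioo a b, (f x * (∫ t in a..x, v t) + c * f x) := by
    refine integral_congr_ae ?_
    filter_upwards [hc] with x hx
    have : u x = (∫ t in a..x, v t) + c := by linarith
    rw [this]; ring
  rw [e, integral_add i3 (hf.const_mul c), integral_const_mul, conv f, hf0]
  simp

/-! ### The energy form and uniqueness of the weak solution -/

/-- The integrand of the bilinear form of the radial problem. -/
def energyDensity (lam mu κ ρ y y' z z' h h' k k' : ℝ) : ℝ :=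
  2 * mu * (ρ * y' * h' + y * h / ρ) + lam * (ρ * (y' + y / ρ + κ * z) * (h' + h / ρ + κ * k))
    + mu * (ρ * (z' - κ * y) * (k' - κ * h)) + 2 * mu * κ ^ 2 * (ρ * z * k)

theorem integrableOn_continuousOn_mul {a b : ℝ} {c u : ℝ → ℝ} (hc : ContinuousOn c (Icc a b))
    (hu : IntegrableOn u (Ioo a b)) : IntegrableOn (fun x => c x * u x) (Ioo a b) := by
  obtain ⟨C, hC⟩ := isCompact_Icc.exists_bound_of_continuousOn hc
  refine Integrable.bdd_mul (c := C) hu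
    ((hc.mono Ioo_subset_Icc_self).aestronglyMeasurable measurableSet_Ioo) ?_
  filter_upwards [ae_restrict_mem measurableSet_Ioo] with x hx using hC x (Ioo_subset_Icc_self hx)

theorem memLp_continuousOn_mul {a b : ℝ} {c u : ℝ → ℝ} (hc : ContinuousOn c (Icc a b))
    (hu : MemLp u 2 (volume.restrict (Ioo a b))) :
    MemLp (fun x => c x * u x) 2 (volume.restrict (Ioo a b)) := by
  obtain ⟨C, hC⟩ := isCompact_Icc.exists_bound_of_continuousOn hc
  refine MemLp.of_le_mul (c := C) hu
    (((hc.mono Ioo_subset_Icc_self).aestronglyMeasurable measurableSet_Ioo).mul hu.1) ?_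
  filter_upwards [ae_restrict_mem measurableSet_Ioo] with x hx
  rw [norm_mul]
  gcongr
  exact hC x (Ioo_subset_Icc_self hx)

theorem memLp_of_continuousOn {a b : ℝ} {u : ℝ → ℝ} (hu : ContinuousOn u (Icc a b)) :
    MemLp u 2 (volume.restrict (Ioo a b)) := by
  simpa using memLp_continuousOn_mul hu (memLp_const (1 : ℝ))

theorem integrableOn_of_memLp_two {a b : ℝ} {u : ℝ → ℝ}
    (hu : MemLp u 2 (volume.restrict (Ioo a b))) : IntegrableOn u (Ioo a b) :=
  hu.integrable (by norm_num)

theorem integrable_mul_mul {a b : ℝ} {c u v : ℝ → ℝ} (hc : ContinuousOn c (Icc a b))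
    (hu : MemLp u 2 (volume.restrict (Ioo a b))) (hv : MemLp v 2 (volume.restrict (Ioo a b))) :
    IntegrableOn (fun x => c x * u x * v x) (Ioo a b) :=
  (memLp_continuousOn_mul hc hu).integrable_mul hv

theorem integrable_and_integral_linear_combination {α : Type*} [MeasurableSpace α] {ν : Measure α}
    {f₁ f₂ f₃ f₄ : α → ℝ} (i₁ : Integrable f₁ ν) (i₂ : Integrable f₂ ν) (i₃ : Integrable f₃ ν)
    (i₄ : Integrable f₄ ν) (c₁ c₂ c₃ c₄ : ℝ) :
    Integrable (fun x => c₁ * f₁ x + c₂ * f₂ x + c₃ * f₃ x + c₄ * f₄ x) ν ∧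
      c₁ * (∫ x, f₁ x ∂ν) + c₂ * (∫ x, f₂ x ∂ν) + c₃ * (∫ x, f₃ x ∂ν) + c₄ * (∫ x, f₄ x ∂ν) =
        ∫ x, (c₁ * f₁ x + c₂ * f₂ x + c₃ * f₃ x + c₄ * f₄ x) ∂ν := by
  have j₂ : Integrable (fun x => c₁ * f₁ x + c₂ * f₂ x) ν :=
    (i₁.const_mul c₁).add (i₂.const_mul c₂)
  have j₃ : Integrable (fun x => c₁ * f₁ x + c₂ * f₂ x + c₃ * f₃ x) ν := j₂.add (i₃.const_mul c₃)
  refine ⟨j₃.add (i₄.const_mul c₄), ?_⟩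
  rw [integral_add j₃ (i₄.const_mul c₄), integral_add j₂ (i₃.const_mul c₃),
    integral_add (i₁.const_mul c₁) (i₂.const_mul c₂), integral_const_mul, integral_const_mul,
    integral_const_mul, integral_const_mul]

section WeakForm

variable {a b lam mu κ : ℝ} {Y Y' Z Z' H H' K K' : ℝ → ℝ}

theorem integrableOn_energyDensity (ha : 0 < a)
    (hY : MemLp Y 2 (volume.restrict (Ioo a b))) (hY' : MemLp Y' 2 (volume.restrict (Ioo a b)))
    (hZ : MemLp Z 2 (volume.restrict (Ioo a b))) (hZ' : MemLp Z' 2 (volume.restrict (Ioo a b)))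
    (hH : MemLp H 2 (volume.restrict (Ioo a b))) (hH' : MemLp H' 2 (volume.restrict (Ioo a b)))
    (hK : MemLp K 2 (volume.restrict (Ioo a b))) (hK' : MemLp K' 2 (volume.restrict (Ioo a b))) :
    IntegrableOn (fun ρ => energyDensity lam mu κ ρ (Y ρ) (Y' ρ) (Z ρ) (Z' ρ) (H ρ) (H' ρ)
        (K ρ) (K' ρ)) (Ioo a b) ∧
      2 * mu * (∫ ρ in Ioo a b, (ρ * Y' ρ * H' ρ + Y ρ * H ρ / ρ))
      + lam * (∫ ρ in Ioo a b,
          ρ * (Y' ρ + Y ρ / ρ + κ * Z ρ) * (H' ρ + H ρ / ρ + κ * K ρ))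
      + mu * (∫ ρ in Ioo a b, ρ * (Z' ρ - κ * Y ρ) * (K' ρ - κ * H ρ))
      + 2 * mu * κ ^ 2 * (∫ ρ in Ioo a b, ρ * Z ρ * K ρ) =
      ∫ ρ in Ioo a b, energyDensity lam mu κ ρ (Y ρ) (Y' ρ) (Z ρ) (Z' ρ) (H ρ) (H' ρ)
        (K ρ) (K' ρ) := by
  have cid : ContinuousOn (fun ρ : ℝ => ρ) (Icc a b) := continuousOn_id
  have cinv : ContinuousOn (fun ρ : ℝ => ρ⁻¹) (Icc a b) :=
    continuousOn_id.inv₀ fun x hx => (ha.trans_le hx.1).ne'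
  have htr : ∀ {y y' z : ℝ → ℝ}, MemLp y 2 (volume.restrict (Ioo a b)) →
      MemLp y' 2 (volume.restrict (Ioo a b)) → MemLp z 2 (volume.restrict (Ioo a b)) →
      MemLp (fun ρ => y' ρ + y ρ / ρ + κ * z ρ) 2 (volume.restrict (Ioo a b)) := by
    intro y y' z hy hy' hz
    have := memLp_continuousOn_mul cinv hy
    simp only [inv_mul_eq_div] at this
    exact (hy'.add this).add (hz.const_mul κ)
  have i₁ : IntegrableOn (fun ρ => ρ * Y' ρ * H' ρ + Y ρ * H ρ / ρ) (Ioo a b) := by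
    refine (integrable_mul_mul cid hY' hH').add ((integrable_mul_mul cinv hY hH).congr ?_)
    exact ae_of_all _ fun ρ => by simp only; ring
  have i₂ : IntegrableOn (fun ρ => ρ * (Y' ρ + Y ρ / ρ + κ * Z ρ) * (H' ρ + H ρ / ρ + κ * K ρ))
      (Ioo a b) := integrable_mul_mul cid (htr hY hY' hZ) (htr hH hH' hK)
  have i₃ : IntegrableOn (fun ρ => ρ * (Z' ρ - κ * Y ρ) * (K' ρ - κ * H ρ)) (Ioo a b) :=
    integrable_mul_mul cid (hZ'.sub (hY.const_mul κ)) (hK'.sub (hH.const_mul κ))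
  have i₄ : IntegrableOn (fun ρ => ρ * Z ρ * K ρ) (Ioo a b) := integrable_mul_mul cid hZ hK
  exact integrable_and_integral_linear_combination i₁ i₂ i₃ i₄ _ _ _ _

end WeakForm

theorem IsH1With.sub {a b : ℝ} {u v u₁ v₁ : ℝ → ℝ} (h : IsH1With a b u v)
    (h₁ : IsH1With a b u₁ v₁) : IsH1With a b (fun x => u x - u₁ x) (fun x => v x - v₁ x) := by
  refine ⟨h.memLp.sub h₁.memLp, h.memLp_deriv.sub h₁.memLp_deriv, fun φ hφ hφc hφt => ?_⟩
  have hd : Continuous (deriv φ) := hφ.continuous_deriv (by simp)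
  obtain ⟨C, hC⟩ := hd.bounded_above_of_compact_support hφc.deriv
  obtain ⟨C', hC'⟩ := hφ.continuous.bounded_above_of_compact_support hφc
  have i : ∀ w : ℝ → ℝ, MemLp w 2 (volume.restrict (Ioo a b)) →
      IntegrableOn (fun x => w x * deriv φ x) (Ioo a b) := fun w hw =>
    Integrable.mul_bdd (integrableOn_of_memLp_two hw) hd.aestronglyMeasurable (ae_of_all _ hC)
  have i' : ∀ w : ℝ → ℝ, MemLp w 2 (volume.restrict (Ioo a b)) →
      IntegrableOn (fun x => w x * φ x) (Ioo a b) := fun w hw =>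
    Integrable.mul_bdd (integrableOn_of_memLp_two hw) hφ.continuous.aestronglyMeasurable
      (ae_of_all _ hC')
  simp only [sub_mul]
  rw [integral_sub (i _ h.memLp) (i _ h₁.memLp), integral_sub (i' _ h.memLp_deriv)
    (i' _ h₁.memLp_deriv), h.weakDeriv φ hφ hφc hφt, h₁.weakDeriv φ hφ hφc hφt]
  ring

theorem isH1With_of_hasDerivAt {a b : ℝ} (hab : a < b) {u v : ℝ → ℝ}
    (h : ∀ x ∈ Icc a b, HasDerivAt u (v x) x) (hv : ContinuousOn v (Icc a b)) :
    IsH1With a b u v := by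
  have hu : ContinuousOn u (Icc a b) := fun x hx => (h x hx).continuousAt.continuousWithinAt
  refine ⟨memLp_of_continuousOn hu, memLp_of_continuousOn hv, fun φ hφ hφc hφt => ?_⟩
  have conv : ∀ g : ℝ → ℝ, ∫ x in Ioo a b, g x = ∫ x in a..b, g x := fun g => by
    rw [intervalIntegral.integral_of_le hab.le, integral_Ioc_eq_integral_Ioo]
  have hφ0 : ∀ x, x ∉ Ioo a b → φ x = 0 := fun x hx =>
    image_eq_zero_of_notMem_tsupport fun h => hx (hφt h)
  have hd : Continuous (deriv φ) := hφ.continuous_deriv (by simp)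
  rw [conv, conv, intervalIntegral.integral_mul_deriv_eq_deriv_mul
    (fun x hx => h x (by rwa [uIcc_of_le hab.le] at hx))
    (fun x _ => (hφ.differentiable (by simp) x).hasDerivAt)
    (by rw [← uIcc_of_le hab.le] at hv; exact hv.intervalIntegrable) (hd.intervalIntegrable _ _),
    hφ0 a (by simp), hφ0 b (by simp)]
  simp

/-- The elastic energy in terms of the normal strains `y'`, `y / ρ`, `κ z`, their trace, and the
shear `z' - κ y`. -/
theorem energyDensity_self {lam mu κ ρ : ℝ} (hρ : 0 < ρ) (y y' z z' : ℝ) :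
    energyDensity lam mu κ ρ y y' z z' y y' z z' =
      ρ * (2 * mu * (y' ^ 2 + (y / ρ) ^ 2 + (κ * z) ^ 2) + lam * (y' + y / ρ + κ * z) ^ 2 +
        mu * (z' - κ * y) ^ 2) := by
  unfold energyDensity
  field_simp
  ring

/-- For negative `lam` the trace term is controlled by Cauchy–Schwarz, `(e₁ + e₂ + e₃)² ≤ 3 (e₁² +
e₂² + e₃²)`, which leaves the constant `3 * lam + 2 * mu`. -/
theorem exists_coercivity_const {lam mu : ℝ} (hmu : 0 < mu) (hlam : 0 < 3 * lam + 2 * mu) :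
    ∃ m : ℝ, 0 < m ∧ ∀ e₁ e₂ e₃ : ℝ, m * (e₁ ^ 2 + e₂ ^ 2 + e₃ ^ 2) ≤
      2 * mu * (e₁ ^ 2 + e₂ ^ 2 + e₃ ^ 2) + lam * (e₁ + e₂ + e₃) ^ 2 := by
  rcases le_or_gt 0 lam with h | h
  · exact ⟨2 * mu, by linarith, fun e₁ e₂ e₃ => by
      have := mul_nonneg h (sq_nonneg (e₁ + e₂ + e₃)); linarith⟩
  · refine ⟨3 * lam + 2 * mu, hlam, fun e₁ e₂ e₃ => ?_⟩
    have h1 : (e₁ + e₂ + e₃) ^ 2 ≤ 3 * (e₁ ^ 2 + e₂ ^ 2 + e₃ ^ 2) := by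
      nlinarith [sq_nonneg (e₁ - e₂), sq_nonneg (e₂ - e₃), sq_nonneg (e₁ - e₃)]
    nlinarith [mul_le_mul_of_nonpos_left h1 h.le]

/-- Both weak identities are tested with the difference of the solutions. The energy density of the
difference is nonnegative with zero integral, and it bounds the squares of `(Y - Y₁) / ρ` and `κ (Z
- Z₁)` pointwise, so no Korn or Poincaré inequality is needed. -/
theorem IsRadialBVPSolution.unique {a b lam mu κ : ℝ} {g : ℝ → ℝ} (ha : 0 < a) (hmu : 0 < mu)
    (hlam : 0 < 3 * lam + 2 * mu) (hκ : κ ≠ 0) {Y Z Y₁ Z₁ : ℝ → ℝ}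
    (h : IsRadialBVPSolution a b lam mu κ g Y Z) (h₁ : IsRadialBVPSolution a b lam mu κ g Y₁ Z₁) :
    ∀ᵐ ρ ∂(volume.restrict (Ioo a b)), Y ρ = Y₁ ρ ∧ Z ρ = Z₁ ρ := by
  obtain ⟨Y', Z', hY, hZ, hw⟩ := h
  obtain ⟨Y₁', Z₁', hY₁, hZ₁, hw₁⟩ := h₁
  have hD := hY.sub hY₁
  have hE := hZ.sub hZ₁
  have e := hw _ _ _ _ hD hE
  have e₁ := hw₁ _ _ _ _ hD hE
  obtain ⟨i, j⟩ := integrableOn_energyDensity (lam := lam) (mu := mu) (κ := κ) ha hY.memLp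
    hY.memLp_deriv hZ.memLp hZ.memLp_deriv hD.memLp hD.memLp_deriv hE.memLp hE.memLp_deriv
  obtain ⟨i₁, j₁⟩ := integrableOn_energyDensity (lam := lam) (mu := mu) (κ := κ) ha hY₁.memLp
    hY₁.memLp_deriv hZ₁.memLp hZ₁.memLp_deriv hD.memLp hD.memLp_deriv hE.memLp hE.memLp_deriv
  rw [j] at e
  rw [j₁] at e₁
  have e₂ := integral_sub i i₁
  rw [e, e₁, sub_self] at e₂
  have e₃ : ∀ ρ, energyDensity lam mu κ ρ (Y ρ) (Y' ρ) (Z ρ) (Z' ρ) (Y ρ - Y₁ ρ)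
      (Y' ρ - Y₁' ρ) (Z ρ - Z₁ ρ) (Z' ρ - Z₁' ρ) -
      energyDensity lam mu κ ρ (Y₁ ρ) (Y₁' ρ) (Z₁ ρ) (Z₁' ρ) (Y ρ - Y₁ ρ)
      (Y' ρ - Y₁' ρ) (Z ρ - Z₁ ρ) (Z' ρ - Z₁' ρ) =
      energyDensity lam mu κ ρ (Y ρ - Y₁ ρ) (Y' ρ - Y₁' ρ) (Z ρ - Z₁ ρ) (Z' ρ - Z₁' ρ)
      (Y ρ - Y₁ ρ) (Y' ρ - Y₁' ρ) (Z ρ - Z₁ ρ) (Z' ρ - Z₁' ρ) := fun ρ => by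
    simp only [energyDensity]; ring
  simp only [e₃] at e₂
  obtain ⟨m, hm, hcoer⟩ := exists_coercivity_const hmu hlam
  have hlow : ∀ ρ ∈ Ioo a b, ∀ y y' z z' : ℝ,
      ρ * (m * (y' ^ 2 + (y / ρ) ^ 2 + (κ * z) ^ 2)) ≤
        energyDensity lam mu κ ρ y y' z z' y y' z z' := by
    intro ρ hρ y y' z z'
    have hρ0 : 0 < ρ := ha.trans hρ.1
    rw [energyDensity_self hρ0]
    refine mul_le_mul_of_nonneg_left ?_ hρ0.le
    have := hcoer y' (y / ρ) (κ * z)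
    have := mul_nonneg hmu.le (sq_nonneg (z' - κ * y))
    linarith
  have hi := i.sub i₁
  have hz := (setIntegral_eq_zero_iff_of_nonneg_ae (s := Ioo a b) (μ := volume) ?_ ?_).1 e₂
  · filter_upwards [hz, ae_restrict_mem measurableSet_Ioo] with ρ hρz hρ
    have hρ0 : 0 < ρ := ha.trans hρ.1
    have h1 := hlow ρ hρ (Y ρ - Y₁ ρ) (Y' ρ - Y₁' ρ) (Z ρ - Z₁ ρ) (Z' ρ - Z₁' ρ)
    rw [hρz, Pi.zero_apply] at h1
    have h2 : 0 < ρ * m := mul_pos hρ0 hm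
    have q1 := sq_nonneg (Y' ρ - Y₁' ρ)
    have q2 := sq_nonneg ((Y ρ - Y₁ ρ) / ρ)
    have q3 := sq_nonneg (κ * (Z ρ - Z₁ ρ))
    have h3 : (Y' ρ - Y₁' ρ) ^ 2 + ((Y ρ - Y₁ ρ) / ρ) ^ 2 + (κ * (Z ρ - Z₁ ρ)) ^ 2 ≤ 0 := by
      by_contra hcon
      have := mul_pos h2 (not_le.1 hcon)
      linarith
    have h4 : ((Y ρ - Y₁ ρ) / ρ) ^ 2 = 0 := by linarith
    have h5 : (κ * (Z ρ - Z₁ ρ)) ^ 2 = 0 := by linarith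
    rw [pow_eq_zero_iff two_ne_zero, div_eq_zero_iff] at h4
    rw [pow_eq_zero_iff two_ne_zero, mul_eq_zero] at h5
    exact ⟨sub_eq_zero.1 (h4.resolve_right hρ0.ne'), sub_eq_zero.1 (h5.resolve_left hκ)⟩
  · filter_upwards [ae_restrict_mem measurableSet_Ioo] with ρ hρ
    refine le_trans ?_ (hlow ρ hρ _ _ _ _)
    have hρ0 : 0 < ρ := ha.trans hρ.1
    positivity
  · exact hi.congr (ae_of_all _ fun ρ => e₃ ρ)

/-! ### Power series converging for all positive radii -/

/-- The power series with coefficients `s` converges on `(0, ∞)`. -/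
def ConvergesEverywhere (s : ℕ → ℝ) : Prop :=
  ∀ ρ : ℝ, 0 < ρ → Summable fun n => s n * ρ ^ n

/-- The sum of the power series with coefficients `s`. -/
def powSum (s : ℕ → ℝ) (ρ : ℝ) : ℝ := ∑' n, s n * ρ ^ n

/-- The sequence `x, s 0, s 1, …`. -/
def prepend (x : ℝ) (s : ℕ → ℝ) : ℕ → ℝ
  | 0 => x
  | n + 1 => s n

namespace ConvergesEverywhere

variable {s t : ℕ → ℝ}

theorem exists_bound (hs : ConvergesEverywhere s) {r : ℝ} (hr : 0 < r) :
    ∃ M, ∀ n, |s n| * r ^ n ≤ M := by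
  obtain ⟨M, hM⟩ := (hs r hr).tendsto_atTop_zero.norm.bddAbove_range
  refine ⟨M, fun n => ?_⟩
  have := hM ⟨n, rfl⟩
  simpa [abs_of_pos hr] using this

/-- Boundedness of the terms at `2ρ` gives a geometric majorant of ratio `1 / 2` at `ρ`; convergence
at every radius thus amounts to boundedness at every radius. -/
theorem summable_abs_of_bound (h : ∀ r : ℝ, 0 < r → ∃ M, ∀ n, |s n| * r ^ n ≤ M) {ρ : ℝ}
    (hρ : 0 < ρ) : Summable fun n => |s n| * ρ ^ n := by
  obtain ⟨M, hM⟩ := h (2 * ρ) (by positivity)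
  refine Summable.of_nonneg_of_le (fun n => by positivity) (fun n => ?_)
    ((summable_geometric_of_lt_one (r := 1 / 2) (by norm_num) (by norm_num)).mul_left M)
  have := hM n
  rw [mul_pow] at this
  calc |s n| * ρ ^ n = (|s n| * (2 ^ n * ρ ^ n)) * (1 / 2) ^ n := by
        rw [one_div, inv_pow]; field_simp
    _ ≤ M * (1 / 2) ^ n := by gcongr

theorem summable_abs (hs : ConvergesEverywhere s) {ρ : ℝ} (hρ : 0 < ρ) :
    Summable fun n => |s n| * ρ ^ n :=
  summable_abs_of_bound (fun _ hr => hs.exists_bound hr) hρ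

theorem of_bound (h : ∀ r : ℝ, 0 < r → ∃ M, ∀ n, |s n| * r ^ n ≤ M) : ConvergesEverywhere s :=
  fun ρ hρ => Summable.of_norm (by
    simpa [abs_of_pos hρ] using summable_abs_of_bound h hρ)

theorem add (hs : ConvergesEverywhere s) (ht : ConvergesEverywhere t) :
    ConvergesEverywhere fun n => s n + t n :=
  fun ρ hρ => by simpa only [add_mul] using (hs ρ hρ).add (ht ρ hρ)

theorem const_mul (hs : ConvergesEverywhere s) (c : ℝ) :
    ConvergesEverywhere fun n => c * s n :=
  fun ρ hρ => by simpa only [mul_assoc] using (hs ρ hρ).mul_left c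

theorem sum {ι : Type*} (u : Finset ι) {f : ι → ℕ → ℝ} (h : ∀ i ∈ u, ConvergesEverywhere (f i)) :
    ConvergesEverywhere fun n => ∑ i ∈ u, f i n :=
  fun ρ hρ => by simpa only [Finset.sum_mul] using summable_sum fun i hi => h i hi ρ hρ

/-- The factor `n ≤ 2 ^ n` is absorbed by doubling the radius. -/
theorem natCast_mul (hs : ConvergesEverywhere s) : ConvergesEverywhere fun n => n * s n := by
  refine of_bound fun r hr => ?_
  obtain ⟨M, hM⟩ := hs.exists_bound (r := 2 * r) (by positivity)
  refine ⟨M, fun n => le_trans ?_ (hM n)⟩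
  have h2 : (n : ℝ) ≤ 2 ^ n := by exact_mod_cast Nat.lt_two_pow_self.le
  rw [abs_mul, Nat.abs_cast, mul_pow]
  calc (n : ℝ) * |s n| * r ^ n = |s n| * (n * r ^ n) := by ring
    _ ≤ |s n| * (2 ^ n * r ^ n) := by gcongr

theorem prepend (hs : ConvergesEverywhere s) (x : ℝ) : ConvergesEverywhere (prepend x s) :=
  fun ρ hρ => by
    rw [← summable_nat_add_iff 1]
    refine ((hs ρ hρ).mul_left ρ).congr fun n => ?_
    simp only [HollowCylinder.prepend, pow_succ]; ring

theorem tail (hs : ConvergesEverywhere s) : ConvergesEverywhere fun n => s (n + 1) :=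
  fun ρ hρ => by
    have := ((summable_nat_add_iff 1).2 (hs ρ hρ)).mul_left ρ⁻¹
    refine this.congr fun n => ?_
    rw [pow_succ]
    field_simp

/-- Termwise differentiation on `(0, 2ρ)`, phrased through `ρ d/dρ`, which multiplies the `n`-th
coefficient by `n` without shifting indices. -/
theorem hasDerivAt (hs : ConvergesEverywhere s) {ρ : ℝ} (hρ : 0 < ρ) :
    HasDerivAt (powSum s) (powSum (fun n => n * s n) ρ / ρ) ρ := by
  have hsum' : Summable fun n : ℕ => |s n| * (n * (2 * ρ) ^ (n - 1)) := by
    have := (hs.natCast_mul.summable_abs (ρ := 2 * ρ) (by positivity)).mul_left (2 * ρ)⁻¹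
    refine this.congr fun n => ?_
    rcases n with _ | n
    · simp
    · simp only [abs_mul, Nat.abs_cast, Nat.add_sub_cancel, pow_succ]
      field_simp
  have := hasDerivAt_tsum_of_isPreconnected (t := Ioo 0 (2 * ρ)) (y := ρ) (y₀ := ρ)
    (g := fun n y => s n * y ^ n) (g' := fun n y => s n * (n * y ^ (n - 1))) hsum' isOpen_Ioo
    isPreconnected_Ioo (fun n y _ => (hasDerivAt_pow n y).const_mul (s n))
    (fun n y hy => by
      have hy0 : 0 < y := hy.1
      have hy1 : y ≤ 2 * ρ := hy.2.le
      rw [norm_mul, norm_mul, norm_pow, Real.norm_eq_abs, Real.norm_eq_abs, Real.norm_eq_abs,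
        Nat.abs_cast, abs_of_pos hy0]
      gcongr)
    ⟨hρ, by linarith⟩ (hs ρ hρ) ⟨hρ, by linarith⟩
  convert! this using 1
  rw [powSum, div_eq_inv_mul, ← tsum_mul_left]
  refine tsum_congr fun n => ?_
  rcases n with _ | n
  · simp
  · simp only [Nat.add_sub_cancel, pow_succ]
    field_simp

end ConvergesEverywhere

theorem powSum_prepend {s : ℕ → ℝ} (hs : ConvergesEverywhere s) (x : ℝ) {ρ : ℝ} (hρ : 0 < ρ) :
    powSum (prepend x s) ρ = x + ρ * powSum s ρ := by
  rw [powSum, (hs.prepend x ρ hρ).tsum_eq_zero_add, powSum, ← tsum_mul_left]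
  congr 1
  · simp [prepend]
  · refine tsum_congr fun n => ?_
    simp only [prepend, pow_succ]; ring

theorem powSum_eq_add_tail {s : ℕ → ℝ} (hs : ConvergesEverywhere s) {ρ : ℝ} (hρ : 0 < ρ) :
    powSum s ρ = s 0 + ρ * powSum (fun n => s (n + 1)) ρ := by
  rw [← powSum_prepend hs.tail _ hρ]
  congr 1
  ext n; cases n <;> rfl

theorem powSum_add {s t : ℕ → ℝ} (hs : ConvergesEverywhere s) (ht : ConvergesEverywhere t)
    {ρ : ℝ} (hρ : 0 < ρ) : powSum (fun n => s n + t n) ρ = powSum s ρ + powSum t ρ := by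
  simp only [powSum, add_mul]
  exact (hs ρ hρ).tsum_add (ht ρ hρ)

theorem powSum_const_mul (c : ℝ) (s : ℕ → ℝ) (ρ : ℝ) :
    powSum (fun n => c * s n) ρ = c * powSum s ρ := by
  simp only [powSum, mul_assoc, tsum_mul_left]

theorem powSum_sum {ι : Type*} (u : Finset ι) {f : ι → ℕ → ℝ}
    (h : ∀ i ∈ u, ConvergesEverywhere (f i)) {ρ : ℝ} (hρ : 0 < ρ) :
    powSum (fun n => ∑ i ∈ u, f i n) ρ = ∑ i ∈ u, powSum (f i) ρ := by
  simp only [powSum, Finset.sum_mul]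
  exact Summable.tsum_finsetSum fun i hi => h i hi ρ hρ

theorem tendsto_powSum_zero {s : ℕ → ℝ} (hs : ConvergesEverywhere s) :
    Filter.Tendsto (powSum s) (nhdsWithin 0 (Ioi 0)) (nhds (s 0)) := by
  have hC : Summable fun n => |s (n + 1)| := by simpa using hs.tail.summable_abs one_pos
  have hb : ∀ᶠ ρ in nhdsWithin (0 : ℝ) (Ioi 0),
      ‖powSum s ρ - s 0‖ ≤ ρ * ∑' n, |s (n + 1)| := by
    filter_upwards [Ioo_mem_nhdsGT (zero_lt_one' ℝ)] with ρ hρ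
    rw [powSum_eq_add_tail hs hρ.1, add_sub_cancel_left, norm_mul, Real.norm_eq_abs ρ,
      abs_of_pos hρ.1]
    refine mul_le_mul_of_nonneg_left ?_ hρ.1.le
    refine tsum_of_norm_bounded hC.hasSum fun n => ?_
    rw [norm_mul, norm_pow, Real.norm_eq_abs, Real.norm_eq_abs, abs_of_pos hρ.1]
    exact mul_le_of_le_one_right (abs_nonneg _) (pow_le_one₀ hρ.1.le hρ.2.le)
  have h0 : Filter.Tendsto (fun ρ : ℝ => ρ * ∑' n, |s (n + 1)|) (nhdsWithin 0 (Ioi 0))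
      (nhds 0) := by
    have : Filter.Tendsto (fun ρ : ℝ => ρ * ∑' n, |s (n + 1)|) (nhds 0)
        (nhds (0 * ∑' n, |s (n + 1)|)) := (continuous_id.mul continuous_const).tendsto 0
    rw [zero_mul] at this
    exact this.mono_left nhdsWithin_le_nhds
  exact tendsto_sub_nhds_zero_iff.1 (squeeze_zero_norm' hb h0)

/-! ### Logarithmic sums and uniqueness of their coefficients -/

/-- The sum `∑ aₙ ρⁿ + ln ρ ∑ bₙ ρⁿ`. -/
def logSum (a b : ℕ → ℝ) (ρ : ℝ) : ℝ := powSum a ρ + Real.log ρ * powSum b ρ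

/-- Dividing by `log ρ → -∞` as `ρ → 0` forces `b 0 = 0`; the logarithmic part is then `O(ρ log ρ)`,
which forces `a 0 = 0`. -/
theorem coeff_zero_eq_zero_of_logSum_eq_zero {a b : ℕ → ℝ} (ha : ConvergesEverywhere a)
    (hb : ConvergesEverywhere b) (h : ∀ ρ, 0 < ρ → logSum a b ρ = 0) : a 0 = 0 ∧ b 0 = 0 := by
  have hA := tendsto_powSum_zero ha
  have hB := tendsto_powSum_zero hb
  have hb0 : b 0 = 0 := by
    have h1 : Filter.Tendsto (fun ρ => -powSum a ρ * (Real.log ρ)⁻¹) (nhdsWithin 0 (Ioi 0))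
        (nhds (-a 0 * 0)) :=
      hA.neg.mul (tendsto_inv_atBot_zero.comp Real.tendsto_log_nhdsGT_zero)
    rw [mul_zero] at h1
    refine tendsto_nhds_unique (hB.congr' ?_) h1
    filter_upwards [Ioo_mem_nhdsGT (zero_lt_one' ℝ)] with ρ hρ
    have hl : Real.log ρ ≠ 0 := (Real.log_neg hρ.1 hρ.2).ne
    have := h ρ hρ.1
    rw [logSum] at this
    field_simp
    linarith
  refine ⟨?_, hb0⟩
  have hl : Filter.Tendsto (fun ρ : ℝ => Real.log ρ * ρ) (nhdsWithin 0 (Ioi 0)) (nhds 0) := by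
    simpa using tendsto_log_mul_rpow_nhdsGT_zero one_pos
  have h1 := (hl.mul (tendsto_powSum_zero hb.tail)).neg
  rw [zero_mul, neg_zero] at h1
  refine tendsto_nhds_unique (hA.congr' ?_) h1
  filter_upwards [self_mem_nhdsWithin] with ρ hρ
  have := h ρ hρ
  rw [logSum, powSum_eq_add_tail hb hρ, hb0] at this
  linarith

/-- Once the leading coefficients vanish, a factor `ρ` splits off and the shifted sequences satisfy
the same hypothesis. -/
theorem coeff_eq_zero_of_logSum_eq_zero {a b : ℕ → ℝ} (ha : ConvergesEverywhere a)
    (hb : ConvergesEverywhere b) (h : ∀ ρ, 0 < ρ → logSum a b ρ = 0) (n : ℕ) :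
    a n = 0 ∧ b n = 0 := by
  induction n generalizing a b with
  | zero => exact coeff_zero_eq_zero_of_logSum_eq_zero ha hb h
  | succ n ih =>
    obtain ⟨h0, h0'⟩ := coeff_zero_eq_zero_of_logSum_eq_zero ha hb h
    refine ih ha.tail hb.tail fun ρ hρ => ?_
    have := h ρ hρ
    rw [logSum, powSum_eq_add_tail ha hρ, powSum_eq_add_tail hb hρ, h0, h0'] at this
    have h2 : ρ * logSum (fun n => a (n + 1)) (fun n => b (n + 1)) ρ = 0 := by
      rw [logSum]; linarith
    exact (mul_eq_zero.1 h2).resolve_left hρ.ne'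

theorem coeff_eq_of_logSum_eq {a b a' b' : ℕ → ℝ} (ha : ConvergesEverywhere a)
    (hb : ConvergesEverywhere b) (ha' : ConvergesEverywhere a') (hb' : ConvergesEverywhere b')
    (h : ∀ ρ, 0 < ρ → logSum a b ρ = logSum a' b' ρ) : a = a' ∧ b = b' := by
  have key := coeff_eq_zero_of_logSum_eq_zero (ha.add (ha'.const_mul (-1)))
    (hb.add (hb'.const_mul (-1))) (fun ρ hρ => by
      rw [logSum, powSum_add ha (ha'.const_mul _) hρ, powSum_add hb (hb'.const_mul _) hρ,
        powSum_const_mul, powSum_const_mul]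
      have := h ρ hρ
      simp only [logSum] at this
      linarith)
  exact ⟨funext fun n => by linarith [(key n).1], funext fun n => by linarith [(key n).2]⟩

theorem hasDerivAt_logSum {a b : ℕ → ℝ} (ha : ConvergesEverywhere a)
    (hb : ConvergesEverywhere b) {ρ : ℝ} (hρ : 0 < ρ) :
    HasDerivAt (logSum a b) (logSum (fun n => n * a n + b n) (fun n => n * b n) ρ / ρ) ρ := by
  have := (ha.hasDerivAt hρ).add ((Real.hasDerivAt_log hρ.ne').mul (hb.hasDerivAt hρ))
  convert! this using 1
  rw [logSum, powSum_add ha.natCast_mul hb hρ]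
  field_simp
  ring

theorem LogCoeffs.Converges.convergesEverywhere {q : LogCoeffs} (h : q.Converges) :
    ConvergesEverywhere q.a ∧ ConvergesEverywhere q.b ∧ ConvergesEverywhere q.c ∧
      ConvergesEverywhere q.d :=
  ⟨fun ρ hρ => (h ρ hρ).1, fun ρ hρ => (h ρ hρ).2.1, fun ρ hρ => (h ρ hρ).2.2.1,
    fun ρ hρ => (h ρ hρ).2.2.2⟩

theorem LogCoeffs.converges_iff {q : LogCoeffs} : q.Converges ↔
    ConvergesEverywhere q.a ∧ ConvergesEverywhere q.b ∧ ConvergesEverywhere q.c ∧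
      ConvergesEverywhere q.d :=
  ⟨fun h => h.convergesEverywhere, fun h ρ hρ => ⟨h.1 ρ hρ, h.2.1 ρ hρ, h.2.2.1 ρ hρ, h.2.2.2 ρ hρ⟩⟩

theorem LogCoeffs.sumY_eq (q : LogCoeffs) (ρ : ℝ) :
    q.sumY ρ = q.aNeg * ρ⁻¹ + logSum q.a q.b ρ := by
  rw [LogCoeffs.sumY, logSum, powSum, powSum, add_assoc]

theorem LogCoeffs.sumZ_eq (q : LogCoeffs) (ρ : ℝ) : q.sumZ ρ = logSum q.c q.d ρ := rfl

/-- Multiplying the expansion of `Y` by `ρ` turns the `ρ⁻¹` term into a constant term, so `prepend`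
reduces to sums without negative powers. -/
theorem HasLogExpansion.unique {q q' : LogCoeffs} {Y Z : ℝ → ℝ} (h : HasLogExpansion q Y Z)
    (h' : HasLogExpansion q' Y Z) : q = q' := by
  obtain ⟨ha, hb, hc, hd⟩ := h.1.convergesEverywhere
  obtain ⟨ha', hb', hc', hd'⟩ := h'.1.convergesEverywhere
  obtain ⟨h1, h2⟩ := coeff_eq_of_logSum_eq (ha.prepend q.aNeg) (hb.prepend 0)
    (ha'.prepend q'.aNeg) (hb'.prepend 0) (fun ρ hρ => by
      have := (h.2 ρ hρ).1.symm.trans (h'.2 ρ hρ).1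
      rw [q.sumY_eq, q'.sumY_eq] at this
      simp only [logSum] at this ⊢
      rw [powSum_prepend ha _ hρ, powSum_prepend hb _ hρ, powSum_prepend ha' _ hρ,
        powSum_prepend hb' _ hρ]
      field_simp at this
      linarith)
  obtain ⟨h3, h4⟩ := coeff_eq_of_logSum_eq hc hd hc' hd'
    (fun ρ hρ => (h.2 ρ hρ).2.symm.trans (h'.2 ρ hρ).2)
  cases q; cases q'
  simp only [LogCoeffs.mk.injEq]
  exact ⟨congrFun h1 0, funext fun n => congrFun h1 (n + 1), funext fun n => congrFun h2 (n + 1),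
    h3, h4⟩

/-- The linear combination of expansions with coefficients `C`. -/
def LogCoeffs.combination (C : Fin 4 → ℝ) (q : Fin 4 → LogCoeffs) : LogCoeffs where
  aNeg := ∑ j, C j * (q j).aNeg
  a n := ∑ j, C j * (q j).a n
  b n := ∑ j, C j * (q j).b n
  c n := ∑ j, C j * (q j).c n
  d n := ∑ j, C j * (q j).d n

theorem ConvergesEverywhere.combination {f : Fin 4 → ℕ → ℝ} (hf : ∀ j, ConvergesEverywhere (f j))
    (C : Fin 4 → ℝ) : ConvergesEverywhere fun n => ∑ j, C j * f j n :=
  ConvergesEverywhere.sum Finset.univ (f := fun j n => C j * f j n) fun j _ => (hf j).const_mul (C j)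

theorem logSum_combination {f g : Fin 4 → ℕ → ℝ} (hf : ∀ j, ConvergesEverywhere (f j))
    (hg : ∀ j, ConvergesEverywhere (g j)) (C : Fin 4 → ℝ) {ρ : ℝ} (hρ : 0 < ρ) :
    logSum (fun n => ∑ j, C j * f j n) (fun n => ∑ j, C j * g j n) ρ =
      ∑ j, C j * logSum (f j) (g j) ρ := by
  rw [logSum, powSum_sum Finset.univ (f := fun j n => C j * f j n)
      (fun j _ => (hf j).const_mul (C j)) hρ,
    powSum_sum Finset.univ (f := fun j n => C j * g j n) (fun j _ => (hg j).const_mul (C j)) hρ,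
    Finset.mul_sum, ← Finset.sum_add_distrib]
  refine Finset.sum_congr rfl fun j _ => ?_
  rw [powSum_const_mul, powSum_const_mul, logSum]
  ring

theorem LogCoeffs.hasLogExpansion_combination {C : Fin 4 → ℝ} {q : Fin 4 → LogCoeffs}
    (h : ∀ j, (q j).Converges) :
    HasLogExpansion (combination C q) (fun ρ => ∑ j, C j * (q j).sumY ρ)
      (fun ρ => ∑ j, C j * (q j).sumZ ρ) := by
  have ha := fun j => (h j).convergesEverywhere.1
  have hb := fun j => (h j).convergesEverywhere.2.1
  have hc := fun j => (h j).convergesEverywhere.2.2.1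
  have hd := fun j => (h j).convergesEverywhere.2.2.2
  refine ⟨LogCoeffs.converges_iff.2 ⟨.combination ha C, .combination hb C, .combination hc C,
    .combination hd C⟩, fun ρ hρ => ⟨?_, ?_⟩⟩
  · rw [sumY_eq, combination, logSum_combination ha hb C hρ, Finset.sum_mul,
      ← Finset.sum_add_distrib]
    refine Finset.sum_congr rfl fun j _ => ?_
    rw [sumY_eq]; ring
  · rw [sumZ_eq, combination, logSum_combination hc hd C hρ]
    rfl

theorem LogCoeffs.free_combination_apply (C : Fin 4 → ℝ) (q : Fin 4 → LogCoeffs) (i : Fin 4) :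
    (combination C q).free i = ∑ j, C j * (q j).free i := by
  fin_cases i <;> rfl

theorem LogCoeffs.free_combination (C : Fin 4 → ℝ) {q : Fin 4 → LogCoeffs}
    (h : ∀ j, (q j).free = Pi.single j 1) : (combination C q).free = C := by
  funext i
  rw [free_combination_apply]
  simp only [h]
  simp [Pi.single_apply]

/-! ### The Frobenius recursion and its convergence -/

/-- The coefficients of `ρⁿ` and of `ρⁿ ln ρ` in the expansions of `Y` and `Z`. -/
structure FrobeniusTerm where
  a : ℝ
  b : ℝ
  c : ℝ
  d : ℝ

/-- The recursion for the coefficients of order `N`, given those of order `N - 1` (`p`) and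
`N - 2` (`q`). -/
def frobeniusStep (A B G D N : ℝ) (p q : FrobeniusTerm) : FrobeniusTerm :=
  -- The divisors are the indicial polynomials, nonzero for `N ≥ 2`. The logarithmic coefficients
  -- come first since `θ²` applied to `ρ^N log ρ` also produces `2 N ρ^N`, which feeds into `a` and
  -- `c`.
  let b := (A * q.b - B * (N - 1) * p.d) / (N ^ 2 - 1)
  let d := (G * q.d + D * N * p.b) / N ^ 2
  { a := (A * q.a - B * ((N - 1) * p.c + p.d) - 2 * N * b) / (N ^ 2 - 1)
    b := b
    c := (G * q.c + D * (N * p.a + p.b) - 2 * N * d) / N ^ 2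
    d := d }

/-- Two consecutive terms of the sequence of coefficients starting with `x₀`, `x₁`. -/
def frobeniusPair (A B G D : ℝ) (x₀ x₁ : FrobeniusTerm) : ℕ → FrobeniusTerm × FrobeniusTerm
  | 0 => (x₀, x₁)
  | n + 1 =>
    let x := frobeniusPair A B G D x₀ x₁ n
    (x.2, frobeniusStep A B G D (n + 2) x.2 x.1)

/-- The sequence of coefficients starting with `x₀`, `x₁`. -/
def frobeniusSeq (A B G D : ℝ) (x₀ x₁ : FrobeniusTerm) (n : ℕ) : FrobeniusTerm :=
  (frobeniusPair A B G D x₀ x₁ n).1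

theorem frobeniusSeq_add_two (A B G D : ℝ) (x₀ x₁ : FrobeniusTerm) (n : ℕ) :
    frobeniusSeq A B G D x₀ x₁ (n + 2) = frobeniusStep A B G D (n + 2)
      (frobeniusSeq A B G D x₀ x₁ (n + 1)) (frobeniusSeq A B G D x₀ x₁ n) := rfl

/-- The `ℓ¹` size of a quadruple of coefficients. -/
def FrobeniusTerm.size (x : FrobeniusTerm) : ℝ := |x.a| + |x.b| + |x.c| + |x.d|

theorem FrobeniusTerm.size_nonneg (x : FrobeniusTerm) : 0 ≤ x.size := by
  unfold size; positivity

theorem abs_comb_le {M x y u v S : ℝ} (hM : |x| ≤ M) (hM' : |y| ≤ M) (hS : |u| + |v| ≤ S) :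
    |x * u + y * v| ≤ M * S := by
  have hM0 : 0 ≤ M := (abs_nonneg x).trans hM
  calc |x * u + y * v| ≤ |x| * |u| + |y| * |v| := by
        rw [← abs_mul, ← abs_mul]; exact abs_add_le _ _
    _ ≤ M * |u| + M * |v| := by gcongr
    _ = M * (|u| + |v|) := by ring
    _ ≤ M * S := by gcongr

/-- Each numerator grows at most linearly in `N` against a quadratic divisor. In units of `M / N *
S`, the coefficients `b` and `d` cost `1` each, `a` costs `3` and `c` costs `2`, which gives the
total `7`. -/
theorem size_frobeniusStep_le (A B G D : ℝ) {N : ℝ} (hN : 2 ≤ N) (p q : FrobeniusTerm) :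
    (frobeniusStep A B G D N p q).size ≤
      7 * (|A| + |B| + |G| + |D|) / N * (p.size + q.size) := by
  set M := |A| + |B| + |G| + |D| with hM
  set S := p.size + q.size with hS
  have hN0 : 0 < N := by linarith
  have hM0 : 0 ≤ M := by positivity
  have hp := p.size_nonneg
  have hq := q.size_nonneg
  have hS0 : 0 ≤ S := by positivity
  have hA : |A| ≤ M := by linarith [abs_nonneg A, abs_nonneg B, abs_nonneg G, abs_nonneg D]
  have hB : |B| ≤ M := by linarith [abs_nonneg A, abs_nonneg B, abs_nonneg G, abs_nonneg D]
  have hG : |G| ≤ M := by linarith [abs_nonneg A, abs_nonneg B, abs_nonneg G, abs_nonneg D]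
  have hD : |D| ≤ M := by linarith [abs_nonneg A, abs_nonneg B, abs_nonneg G, abs_nonneg D]
  have hB' : |-B| ≤ M := by rwa [abs_neg]
  have hpa := abs_nonneg p.a
  have hpb := abs_nonneg p.b
  have hpc := abs_nonneg p.c
  have hpd := abs_nonneg p.d
  have hqa := abs_nonneg q.a
  have hqb := abs_nonneg q.b
  have hqc := abs_nonneg q.c
  have hqd := abs_nonneg q.d
  have hSx : S = |p.a| + |p.b| + |p.c| + |p.d| + (|q.a| + |q.b| + |q.c| + |q.d|) := rfl
  have hN1 : 0 < N ^ 2 - 1 := by nlinarith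
  have w1 : N ≤ N ^ 2 - 1 := by nlinarith
  have w2 : 0 ≤ N - 1 := by linarith
  have hr1 : (N - 1) / (N ^ 2 - 1) ≤ 1 / N := by
    rw [div_le_div_iff₀ hN1 hN0]; nlinarith
  have hr2 : 1 / (N ^ 2 - 1) ≤ 1 / N := one_div_le_one_div_of_le hN0 w1
  have hr3 : 2 * N / (N ^ 2 - 1) ≤ 2 := by
    rw [div_le_iff₀ hN1]; nlinarith
  have hr4 : 1 / N ^ 2 ≤ 1 / N := one_div_le_one_div_of_le hN0 (by nlinarith)
  have hr5 : 2 * N / N ^ 2 ≤ 1 := by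
    rw [div_le_iff₀ (by positivity)]; nlinarith
  have i0 : 0 ≤ 1 / (N ^ 2 - 1) := by positivity
  have i1 : 0 ≤ (N - 1) / (N ^ 2 - 1) := div_nonneg w2 hN1.le
  have i2 : 0 ≤ 1 / N := by positivity
  have i3 : 0 ≤ 1 / N ^ 2 := by positivity
  have cb : |(frobeniusStep A B G D N p q).b| ≤ M / N * S := by
    have e : (frobeniusStep A B G D N p q).b =
        A * (1 / (N ^ 2 - 1) * q.b) + -B * ((N - 1) / (N ^ 2 - 1) * p.d) := by
      simp only [frobeniusStep]; ring
    rw [e, show M / N * S = M * (S / N) by ring]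
    refine abs_comb_le hA hB' ?_
    rw [abs_mul, abs_mul, abs_of_nonneg i0, abs_of_nonneg i1]
    calc _ ≤ 1 / N * |q.b| + 1 / N * |p.d| := by gcongr
      _ = (|q.b| + |p.d|) / N := by ring
      _ ≤ S / N := by gcongr; linarith
  have cd : |(frobeniusStep A B G D N p q).d| ≤ M / N * S := by
    have e : (frobeniusStep A B G D N p q).d =
        G * (1 / N ^ 2 * q.d) + D * (1 / N * p.b) := by
      simp only [frobeniusStep]; field_simp
    rw [e, show M / N * S = M * (S / N) by ring]
    refine abs_comb_le hG hD ?_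
    rw [abs_mul, abs_mul, abs_of_nonneg i3, abs_of_nonneg i2]
    calc _ ≤ 1 / N * |q.d| + 1 / N * |p.b| := by gcongr
      _ = (|q.d| + |p.b|) / N := by ring
      _ ≤ S / N := by gcongr; linarith
  have ca : |(frobeniusStep A B G D N p q).a| ≤ 3 * (M / N * S) := by
    have e : (frobeniusStep A B G D N p q).a =
        (A * (1 / (N ^ 2 - 1) * q.a) +
          -B * ((N - 1) / (N ^ 2 - 1) * p.c + 1 / (N ^ 2 - 1) * p.d)) -
          2 * N / (N ^ 2 - 1) * (frobeniusStep A B G D N p q).b := by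
      simp only [frobeniusStep]; ring
    rw [e]
    have h1 : |A * (1 / (N ^ 2 - 1) * q.a) +
        -B * ((N - 1) / (N ^ 2 - 1) * p.c + 1 / (N ^ 2 - 1) * p.d)| ≤ M / N * S := by
      rw [show M / N * S = M * (S / N) by ring]
      refine abs_comb_le hA hB' ?_
      have t := abs_add_le ((N - 1) / (N ^ 2 - 1) * p.c) (1 / (N ^ 2 - 1) * p.d)
      rw [abs_mul, abs_mul, abs_of_nonneg i0, abs_of_nonneg i1] at t
      rw [abs_mul, abs_of_nonneg i0]
      calc _ ≤ 1 / (N ^ 2 - 1) * |q.a| +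
            ((N - 1) / (N ^ 2 - 1) * |p.c| + 1 / (N ^ 2 - 1) * |p.d|) := by gcongr
        _ ≤ 1 / N * |q.a| + (1 / N * |p.c| + 1 / N * |p.d|) := by gcongr
        _ = (|q.a| + |p.c| + |p.d|) / N := by ring
        _ ≤ S / N := by gcongr; linarith
    have h2 : |2 * N / (N ^ 2 - 1) * (frobeniusStep A B G D N p q).b| ≤ 2 * (M / N * S) := by
      rw [abs_mul, abs_of_nonneg (by positivity)]
      exact mul_le_mul hr3 cb (abs_nonneg _) (by norm_num)
    refine (norm_sub_le (A * (1 / (N ^ 2 - 1) * q.a) +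
        -B * ((N - 1) / (N ^ 2 - 1) * p.c + 1 / (N ^ 2 - 1) * p.d))
        (2 * N / (N ^ 2 - 1) * (frobeniusStep A B G D N p q).b)).trans ?_
    simp only [Real.norm_eq_abs]
    linarith
  have cc : |(frobeniusStep A B G D N p q).c| ≤ 2 * (M / N * S) := by
    have e : (frobeniusStep A B G D N p q).c =
        (G * (1 / N ^ 2 * q.c) + D * (1 / N * p.a + 1 / N ^ 2 * p.b)) -
          2 * N / N ^ 2 * (frobeniusStep A B G D N p q).d := by
      simp only [frobeniusStep]; field_simp
    rw [e]
    have h1 : |G * (1 / N ^ 2 * q.c) + D * (1 / N * p.a + 1 / N ^ 2 * p.b)| ≤ M / N * S := by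
      rw [show M / N * S = M * (S / N) by ring]
      refine abs_comb_le hG hD ?_
      have t := abs_add_le (1 / N * p.a) (1 / N ^ 2 * p.b)
      rw [abs_mul, abs_mul, abs_of_nonneg i2, abs_of_nonneg i3] at t
      rw [abs_mul, abs_of_nonneg i3]
      calc _ ≤ 1 / N ^ 2 * |q.c| + (1 / N * |p.a| + 1 / N ^ 2 * |p.b|) := by gcongr
        _ ≤ 1 / N * |q.c| + (1 / N * |p.a| + 1 / N * |p.b|) := by gcongr
        _ = (|q.c| + |p.a| + |p.b|) / N := by ring
        _ ≤ S / N := by gcongr; linarith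
    have h2 : |2 * N / N ^ 2 * (frobeniusStep A B G D N p q).d| ≤ 1 * (M / N * S) := by
      rw [abs_mul, abs_of_nonneg (by positivity)]
      exact mul_le_mul hr5 cd (abs_nonneg _) (by norm_num)
    refine (norm_sub_le (G * (1 / N ^ 2 * q.c) +
        D * (1 / N * p.a + 1 / N ^ 2 * p.b))
        (2 * N / N ^ 2 * (frobeniusStep A B G D N p q).d)).trans ?_
    simp only [Real.norm_eq_abs]
    linarith
  have e : 7 * M / N * S = 7 * (M / N * S) := by ring
  rw [e, FrobeniusTerm.size]
  linarith

/-- As soon as `n + 2 ≥ K (r + r²)`, a step cannot raise the bound on the weighted terms `s n * r ^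
n`; the finitely many earlier ones are bounded by their sum. -/
theorem exists_bound_of_two_step {s : ℕ → ℝ} (hs : ∀ n, 0 ≤ s n) {K : ℝ} (hK : 0 ≤ K)
    (h : ∀ n : ℕ, s (n + 2) ≤ K / (n + 2) * (s (n + 1) + s n)) {r : ℝ} (hr : 0 < r) :
    ∃ M, ∀ n, s n * r ^ n ≤ M := by
  obtain ⟨N, hN⟩ := exists_nat_ge (K * (r + r ^ 2))
  refine ⟨∑ i ∈ Finset.range (N + 2), s i * r ^ i, fun n => ?_⟩
  set M := ∑ i ∈ Finset.range (N + 2), s i * r ^ i with hM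
  have hM0 : 0 ≤ M := Finset.sum_nonneg fun i _ => mul_nonneg (hs i) (by positivity)
  induction n using Nat.strong_induction_on with
  | _ n ih =>
    rcases lt_or_ge n (N + 2) with hn | hn
    · exact Finset.single_le_sum (f := fun i => s i * r ^ i)
        (fun i _ => mul_nonneg (hs i) (by positivity)) (Finset.mem_range.2 hn)
    · obtain ⟨m, rfl⟩ : ∃ m, n = m + 2 := ⟨n - 2, by omega⟩
      have i1 := ih (m + 1) (by omega)
      have i2 := ih m (by omega)
      have hm : K * (r + r ^ 2) ≤ m + 2 := by
        have : (N : ℝ) ≤ m := by exact_mod_cast (by omega : N ≤ m)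
        linarith
      have hm0 : (0 : ℝ) < m + 2 := by positivity
      calc s (m + 2) * r ^ (m + 2) ≤ K / (m + 2) * (s (m + 1) + s m) * r ^ (m + 2) := by
            gcongr; exact h m
        _ = K / (m + 2) * (r * (s (m + 1) * r ^ (m + 1)) + r ^ 2 * (s m * r ^ m)) := by ring
        _ ≤ K / (m + 2) * (r * M + r ^ 2 * M) := by gcongr
        _ = K * (r + r ^ 2) / (m + 2) * M := by ring
        _ ≤ 1 * M := by
            gcongr
            exact (div_le_one hm0).2 hm
        _ = M := one_mul M

theorem convergesEverywhere_frobeniusSeq (A B G D : ℝ) (x₀ x₁ : FrobeniusTerm) {s : ℕ → ℝ}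
    (hs : ∀ n, |s n| ≤ (frobeniusSeq A B G D x₀ x₁ n).size) : ConvergesEverywhere s := by
  refine ConvergesEverywhere.of_bound fun r hr => ?_
  obtain ⟨M, hM⟩ := exists_bound_of_two_step
    (s := fun n => (frobeniusSeq A B G D x₀ x₁ n).size) (fun n => FrobeniusTerm.size_nonneg _)
    (K := 7 * (|A| + |B| + |G| + |D|)) (by positivity)
    (fun n => by
      rw [frobeniusSeq_add_two]
      exact size_frobeniusStep_le A B G D (by have : (0 : ℝ) ≤ n := n.cast_nonneg; linarith) _ _) hr
  exact ⟨M, fun n => (mul_le_mul_of_nonneg_right (hs n) (by positivity)).trans (hM n)⟩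

/-! ### Series solutions of the homogeneous system -/

theorem logSum_add {a b a' b' : ℕ → ℝ} (ha : ConvergesEverywhere a) (hb : ConvergesEverywhere b)
    (ha' : ConvergesEverywhere a') (hb' : ConvergesEverywhere b') {ρ : ℝ} (hρ : 0 < ρ) :
    logSum (fun n => a n + a' n) (fun n => b n + b' n) ρ = logSum a b ρ + logSum a' b' ρ := by
  simp only [logSum, powSum_add ha ha' hρ, powSum_add hb hb' hρ]; ring

theorem logSum_const_mul (c : ℝ) (a b : ℕ → ℝ) (ρ : ℝ) :
    logSum (fun n => c * a n) (fun n => c * b n) ρ = c * logSum a b ρ := by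
  simp only [logSum, powSum_const_mul]; ring

theorem logSum_prepend {a b : ℕ → ℝ} (ha : ConvergesEverywhere a) (hb : ConvergesEverywhere b)
    (x : ℝ) {ρ : ℝ} (hρ : 0 < ρ) :
    logSum (prepend x a) (prepend 0 b) ρ = x + ρ * logSum a b ρ := by
  simp only [logSum, powSum_prepend ha x hρ, powSum_prepend hb 0 hρ]; ring

/-- The recursion which expresses that `(q.sumY, q.sumZ)` solves the homogeneous system. -/
structure LogCoeffs.IsFrobenius (A B G D : ℝ) (q : LogCoeffs) : Prop where
  eq_a : ∀ n, (n * (n * q.a n + q.b n) + n * q.b n) +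
      B * prepend 0 (fun m => m * q.c m + q.d m) n =
    q.a n + A * prepend 0 (prepend q.aNeg q.a) n
  eq_b : ∀ n, n * (n * q.b n) + B * prepend 0 (fun m => m * q.d m) n =
    q.b n + A * prepend 0 (prepend 0 q.b) n
  eq_c : ∀ n, n * (n * q.c n + q.d n) + n * q.d n =
    G * prepend 0 (prepend 0 q.c) n + D * prepend 0 (fun m => (m * q.a m + q.b m) + q.a m) n
  eq_d : ∀ n, n * (n * q.d n) =
    G * prepend 0 (prepend 0 q.d) n + D * prepend 0 (fun m => m * q.b m + q.b m) n

/-- The recursion is the system times `ρ²`, with `ρ² Y'' + ρ Y' = θ² Y`, compared coefficientwise.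
Since `θ² - 1` and `θ + 1` annihilate `ρ⁻¹`, the coefficient `aNeg` enters only through `A ρ² Y`. -/
theorem LogCoeffs.IsFrobenius.isHomogeneousSolution {lam mu κ : ℝ} {q : LogCoeffs}
    (h : q.IsFrobenius (mu / (lam + 2 * mu) * κ ^ 2) ((lam + mu) / (lam + 2 * mu) * κ)
      ((lam + 2 * mu) / mu * κ ^ 2) ((lam + mu) / mu * κ)) (hq : q.Converges) :
    IsHomogeneousSolution lam mu κ q.sumY q.sumZ := by
  obtain ⟨ha, hb, hc, hd⟩ := hq.convergesEverywhere
  set A := mu / (lam + 2 * mu) * κ ^ 2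
  set B := (lam + mu) / (lam + 2 * mu) * κ
  set G := (lam + 2 * mu) / mu * κ ^ 2
  set D := (lam + mu) / mu * κ
  have ha₁ : ConvergesEverywhere fun n => n * q.a n + q.b n := ha.natCast_mul.add hb
  have hb₁ : ConvergesEverywhere fun n => n * q.b n := hb.natCast_mul
  have hc₁ : ConvergesEverywhere fun n => n * q.c n + q.d n := hc.natCast_mul.add hd
  have hd₁ : ConvergesEverywhere fun n => n * q.d n := hd.natCast_mul
  have ha₂ : ConvergesEverywhere fun n => n * (n * q.a n + q.b n) + n * q.b n :=
    ha₁.natCast_mul.add hb₁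
  have hb₂ : ConvergesEverywhere fun n => n * (n * q.b n) := hb₁.natCast_mul
  have E₁ : ∀ r, 0 < r →
      logSum (fun n => n * (n * q.a n + q.b n) + n * q.b n) (fun n => n * (n * q.b n)) r +
        B * (r * logSum (fun n => n * q.c n + q.d n) (fun n => n * q.d n) r) =
      logSum q.a q.b r + A * (r * (q.aNeg + r * logSum q.a q.b r)) := by
    intro r hr
    have := congrArg₂ (fun s t => logSum s t r) (funext h.eq_a) (funext h.eq_b)
    beta_reduce at this
    rwa [logSum_add ha₂ hb₂ ((hc₁.prepend 0).const_mul B) ((hd₁.prepend 0).const_mul B) hr,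
      logSum_add ha hb (((ha.prepend _).prepend 0).const_mul A)
        (((hb.prepend 0).prepend 0).const_mul A) hr, logSum_const_mul, logSum_const_mul,
      logSum_prepend hc₁ hd₁ 0 hr, logSum_prepend (ha.prepend _) (hb.prepend 0) 0 hr,
      logSum_prepend ha hb _ hr, zero_add, zero_add] at this
  have E₂ : ∀ r, 0 < r →
      logSum (fun n => n * (n * q.c n + q.d n) + n * q.d n) (fun n => n * (n * q.d n)) r =
      G * (r * (r * logSum q.c q.d r)) +
        D * (r * (logSum (fun n => n * q.a n + q.b n) (fun n => n * q.b n) r +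
          logSum q.a q.b r)) := by
    intro r hr
    have := congrArg₂ (fun s t => logSum s t r) (funext h.eq_c) (funext h.eq_d)
    beta_reduce at this
    rwa [logSum_add (((hc.prepend 0).prepend 0).const_mul G)
        (((hd.prepend 0).prepend 0).const_mul G) (((ha₁.add ha).prepend 0).const_mul D)
        (((hb₁.add hb).prepend 0).const_mul D) hr, logSum_const_mul, logSum_const_mul,
      logSum_prepend (hc.prepend 0) (hd.prepend 0) 0 hr, logSum_prepend hc hd 0 hr,
      logSum_prepend (ha₁.add ha) (hb₁.add hb) 0 hr, logSum_add ha₁ hb₁ ha hb hr,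
      zero_add, zero_add, zero_add] at this
  set T₀ := logSum q.a q.b
  set T₁ := logSum (fun n => n * q.a n + q.b n) (fun n => n * q.b n)
  set T₂ := logSum (fun n => n * (n * q.a n + q.b n) + n * q.b n) (fun n => n * (n * q.b n))
  set U₀ := logSum q.c q.d
  set U₁ := logSum (fun n => n * q.c n + q.d n) (fun n => n * q.d n)
  set U₂ := logSum (fun n => n * (n * q.c n + q.d n) + n * q.d n) (fun n => n * (n * q.d n))
  have dT₀ : ∀ r, 0 < r → HasDerivAt T₀ (T₁ r / r) r := fun r hr => hasDerivAt_logSum ha hb hr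
  have dT₁ : ∀ r, 0 < r → HasDerivAt T₁ (T₂ r / r) r := fun r hr => hasDerivAt_logSum ha₁ hb₁ hr
  have dU₀ : ∀ r, 0 < r → HasDerivAt U₀ (U₁ r / r) r := fun r hr => hasDerivAt_logSum hc hd hr
  have dU₁ : ∀ r, 0 < r → HasDerivAt U₁ (U₂ r / r) r := fun r hr => hasDerivAt_logSum hc₁ hd₁ hr
  have dinv : ∀ (x : ℝ) r, 0 < r → HasDerivAt (fun r => x * r⁻¹) (-(x * r⁻¹) / r) r := by
    intro x r hr
    convert! (hasDerivAt_inv hr.ne').const_mul x using 1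
    field_simp
  intro ρ hρ
  have hev : ∀ᶠ r in nhds ρ, 0 < r := Ioi_mem_nhds hρ
  have hY : q.sumY = fun r => q.aNeg * r⁻¹ + T₀ r := funext q.sumY_eq
  have hZ : q.sumZ = U₀ := funext q.sumZ_eq
  have dY : ∀ r, 0 < r → HasDerivAt q.sumY ((-q.aNeg * r⁻¹ + T₁ r) / r) r := by
    intro r hr
    rw [hY]
    convert! (dinv q.aNeg r hr).add (dT₀ r hr) using 1
    ring
  have e₁ := E₁ ρ hρ
  have e₂ := E₂ ρ hρ
  refine SolvesRadialSystemAt.of_hasDerivAt (Y' := fun r => (-q.aNeg * r⁻¹ + T₁ r) / r)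
    (Z' := fun r => U₁ r / r) (hev.mono dY)
    (hev.mono fun r hr => by rw [hZ]; exact dU₀ r hr)
    (((dinv (-q.aNeg) ρ hρ).add (dT₁ ρ hρ)).div (hasDerivAt_id ρ) hρ.ne')
    ((dU₁ ρ hρ).div (hasDerivAt_id ρ) hρ.ne') ?_ ?_
  · change _ + _ - _ - A * _ + B * _ = 0
    simp only [hY, Pi.add_apply]
    linear_combination (norm := (field_simp; ring)) e₁ / ρ ^ 2
  · change _ + _ - G * _ - D * _ = _
    simp only [hY, hZ]
    linear_combination (norm := (field_simp; ring)) e₂ / ρ ^ 2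

/-- The coefficients of the expansion with prescribed free coefficients `(a₋₁, a₁, b₁, c₀)`. -/
def frobeniusCoeffs (A B G D : ℝ) (f : Fin 4 → ℝ) : LogCoeffs :=
  -- At the resonance `N = 1` the terms in `a₁` cancel and the first equation becomes `2 b₁ + B d₀ =
  -- A a₋₁`, which fixes `d₀`. The other orders `0` and `1` equations allow `a₀ = b₀ = c₁ = d₁ = 0`.
  let x := frobeniusSeq A B G D ⟨0, 0, f 3, (A * f 0 - 2 * f 2) / B⟩ ⟨f 1, f 2, 0, 0⟩
  { aNeg := f 0
    a := fun n => (x n).a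
    b := fun n => (x n).b
    c := fun n => (x n).c
    d := fun n => (x n).d }

theorem converges_frobeniusCoeffs (A B G D : ℝ) (f : Fin 4 → ℝ) :
    (frobeniusCoeffs A B G D f).Converges := by
  rw [LogCoeffs.converges_iff]
  refine ⟨?_, ?_, ?_, ?_⟩
  all_goals
    refine convergesEverywhere_frobeniusSeq A B G D ⟨0, 0, f 3, (A * f 0 - 2 * f 2) / B⟩
      ⟨f 1, f 2, 0, 0⟩ fun n => ?_
    simp only [frobeniusCoeffs, FrobeniusTerm.size]
    exact le_of_sub_nonneg (by ring_nf; positivity)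

theorem free_frobeniusCoeffs (A B G D : ℝ) (f : Fin 4 → ℝ) :
    (frobeniusCoeffs A B G D f).free = f := by
  funext i
  fin_cases i <;> rfl

theorem isFrobenius_frobeniusCoeffs (A G D : ℝ) {B : ℝ} (hB : B ≠ 0) (f : Fin 4 → ℝ) :
    (frobeniusCoeffs A B G D f).IsFrobenius A B G D := by
  have hN : ∀ m : ℕ, ((m : ℝ) + 2) ^ 2 - 1 ≠ 0 := fun m => by
    have : (0 : ℝ) ≤ m := m.cast_nonneg
    nlinarith
  have hN' : ∀ m : ℕ, ((m : ℝ) + 2) ≠ 0 := fun m => by positivity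
  constructor
  · rintro (_ | _ | m)
    · simp [frobeniusCoeffs, frobeniusSeq, frobeniusPair, prepend]
    · simp [frobeniusCoeffs, frobeniusSeq, frobeniusPair, prepend]
      field_simp
      ring
    · simp only [frobeniusCoeffs, prepend, frobeniusSeq_add_two]
      push_cast
      have := hN m
      simp only [frobeniusStep]
      field_simp
      ring
  · rintro (_ | _ | m)
    · simp [frobeniusCoeffs, frobeniusSeq, frobeniusPair, prepend]
    · simp [frobeniusCoeffs, frobeniusSeq, frobeniusPair, prepend]
    · simp only [frobeniusCoeffs, prepend, frobeniusSeq_add_two]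
      push_cast
      have := hN m
      simp only [frobeniusStep]
      field_simp
      ring
  · rintro (_ | _ | m)
    · simp [frobeniusCoeffs, frobeniusSeq, frobeniusPair, prepend]
    · simp [frobeniusCoeffs, frobeniusSeq, frobeniusPair, prepend]
    · simp only [frobeniusCoeffs, prepend, frobeniusSeq_add_two]
      push_cast
      have := hN' m
      simp only [frobeniusStep]
      field_simp
      ring
  · rintro (_ | _ | m)
    · simp [frobeniusCoeffs, frobeniusSeq, frobeniusPair, prepend]
    · simp [frobeniusCoeffs, frobeniusSeq, frobeniusPair, prepend]
    · simp only [frobeniusCoeffs, prepend, frobeniusSeq_add_two]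
      push_cast
      have := hN' m
      simp only [frobeniusStep]
      field_simp
      ring

theorem exists_frobenius_solution {lam mu κ : ℝ} (hB : (lam + mu) / (lam + 2 * mu) * κ ≠ 0)
    (f : Fin 4 → ℝ) : ∃ q : LogCoeffs, q.free = f ∧ q.Converges ∧
      IsHomogeneousSolution lam mu κ q.sumY q.sumZ :=
  ⟨frobeniusCoeffs _ _ _ _ f, free_frobeniusCoeffs _ _ _ _ f, converges_frobeniusCoeffs _ _ _ _ f,
    (isFrobenius_frobeniusCoeffs _ _ _ hB f).isHomogeneousSolution
      (converges_frobeniusCoeffs _ _ _ _ f)⟩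

/-- A vanishing combination has zero expansion by uniqueness of coefficients, and its free
coefficients are exactly the constants `C`. -/
theorem isFundamentalSystem_of_free {lam mu κ : ℝ} {q : Fin 4 → LogCoeffs}
    (hc : ∀ j, (q j).Converges) (hf : ∀ j, (q j).free = Pi.single j 1)
    (hs : ∀ j, IsHomogeneousSolution lam mu κ (q j).sumY (q j).sumZ) :
    IsFundamentalSystem lam mu κ (fun j => (q j).sumY) (fun j => (q j).sumZ) := by
  refine ⟨hs, Fintype.linearIndependent_iff.2 fun C hC => ?_⟩
  have h₁ := LogCoeffs.hasLogExpansion_combination (C := C) hc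
  have h₀ := LogCoeffs.hasLogExpansion_combination (C := 0) hc
  have heq : LogCoeffs.combination C q = LogCoeffs.combination 0 q := by
    refine h₁.unique ⟨h₀.1, fun ρ hρ => ?_⟩
    have := congrFun hC ⟨ρ, hρ⟩
    rw [← (h₀.2 ρ hρ).1, ← (h₀.2 ρ hρ).2]
    constructor
    · simpa [Prod.fst_sum] using congrArg Prod.fst this
    · simpa [Prod.snd_sum] using congrArg Prod.snd this
  have := congrArg LogCoeffs.free heq
  rw [LogCoeffs.free_combination C hf, LogCoeffs.free_combination 0 hf] at this
  exact congrFun this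

theorem HasLogExpansion.congr {q : LogCoeffs} {Y Z Y₁ Z₁ : ℝ → ℝ} (h : HasLogExpansion q Y Z)
    (h₁ : ∀ ρ, 0 < ρ → Y₁ ρ = Y ρ ∧ Z₁ ρ = Z ρ) : HasLogExpansion q Y₁ Z₁ :=
  ⟨h.1, fun ρ hρ => ⟨(h₁ ρ hρ).1.trans (h.2 ρ hρ).1, (h₁ ρ hρ).2.trans (h.2 ρ hρ).2⟩⟩

/-! ### From classical to weak solutions -/

theorem IsH1With.integral_mul_deriv {a b : ℝ} (hab : a < b) {H H' F f : ℝ → ℝ} {s : Set ℝ}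
    (h : IsH1With a b H H') (hs : s.Countable) (hF : ContinuousOn F (Icc a b))
    (hFf : ∀ x ∈ Ioo a b \ s, HasDerivAt F (f x) x) (hf : IntegrableOn f (Ioo a b))
    (hFa : F a = 0) (hFb : F b = 0) :
    ∫ x in Ioo a b, F x * H' x = -∫ x in Ioo a b, f x * H x := by
  have hfi : IntervalIntegrable f volume a b :=
    (intervalIntegrable_iff_integrableOn_Ioo_of_le hab.le).2 hf
  have hprim : ∀ x ∈ Icc a b, ∫ t in a..x, f t = F x := fun x hx => by
    rw [integral_eq_of_hasDerivAt_off_countable_of_le F f hx.1 hs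
      (hF.mono (Icc_subset_Icc_right hx.2))
      (fun t ht => hFf t ⟨⟨ht.1.1, ht.1.2.trans_le hx.2⟩, ht.2⟩)
      (hfi.mono_set (by
        rw [uIcc_of_le hx.1, uIcc_of_le hab.le]; exact Icc_subset_Icc_right hx.2)),
      hFa, sub_zero]
  rw [← h.weakDeriv.integral_primitive_mul hab (integrableOn_of_memLp_two h.memLp)
    (integrableOn_of_memLp_two h.memLp_deriv) hf ((hprim b ⟨hab.le, le_rfl⟩).trans hFb)]
  refine setIntegral_congr_fun measurableSet_Ioo fun x hx => ?_
  simp only [hprim x (Ioo_subset_Icc_self hx)]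

/-- The boundary operator of the radial problem, acting on `(Y, Y', Z, Z')`. -/
def boundaryOp (lam mu κ ρ : ℝ) : (Fin 4 → ℝ) →ₗ[ℝ] (Fin 2 → ℝ) :=
  Matrix.mulVecLin !![lam / ρ, lam + 2 * mu, lam * κ, 0; -κ, 0, 0, 1]

theorem boundaryOp_eq_zero_iff {lam mu κ ρ : ℝ} {w : Fin 4 → ℝ} :
    boundaryOp lam mu κ ρ w = 0 ↔
      lam / ρ * w 0 + (lam + 2 * mu) * w 1 + lam * κ * w 2 = 0 ∧ w 3 - κ * w 0 = 0 := by
  rw [funext_iff, Fin.forall_fin_two]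
  simp [boundaryOp, Matrix.mulVec, dotProduct, Fin.sum_univ_four, sub_eq_neg_add]

/-- The energy density is `N₁ H' + G₁ H + N₂ K' + G₂ K`. The equations say `N₁' = G₁` and `N₂' = G₂
- ρ g` off `s`, and the boundary conditions say that `N₁`, `N₂` vanish at both ends, so integration
by parts leaves only the load. -/
theorem isRadialBVPSolution_of_classical {a b lam mu κ : ℝ} (ha : 0 < a) (hab : a < b)
    (hmu : mu ≠ 0) (hlm : lam + 2 * mu ≠ 0) {g : ℝ → ℝ} (hgm : Measurable g) {M : ℝ}
    (hgM : ∀ x, ‖g x‖ ≤ M) {s : Set ℝ} (hs : s.Countable) {u : ℝ → Fin 4 → ℝ}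
    (hc : ContinuousOn u (Ioi 0))
    (h0 : ∀ ρ, 0 < ρ → HasDerivAt (fun r => u r 0) (u ρ 1) ρ)
    (h2 : ∀ ρ, 0 < ρ → HasDerivAt (fun r => u r 2) (u ρ 3) ρ)
    (hu : ∀ ρ, 0 < ρ → ρ ∉ s → HasDerivAt u
      ((sysMatrix lam mu κ ρ).mulVec (u ρ) + ![0, 0, 0, -(1 / mu) * g ρ]) ρ)
    (hBa : boundaryOp lam mu κ a (u a) = 0) (hBb : boundaryOp lam mu κ b (u b) = 0) :
    IsRadialBVPSolution a b lam mu κ g (fun r => u r 0) (fun r => u r 2) := by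
  have hb : 0 < b := ha.trans hab
  have hsub : Icc a b ⊆ Ioi 0 := fun x hx => ha.trans_le hx.1
  have c := continuousOn_pi.1 (hc.mono hsub)
  have c0 : ContinuousOn (fun x => u x 0) (Icc a b) := c 0
  have c1 : ContinuousOn (fun x => u x 1) (Icc a b) := c 1
  have c2 : ContinuousOn (fun x => u x 2) (Icc a b) := c 2
  have c3 : ContinuousOn (fun x => u x 3) (Icc a b) := c 3
  have hne : ∀ x ∈ Icc a b, x ≠ 0 := fun x hx => (hsub hx).ne'
  rw [boundaryOp_eq_zero_iff] at hBa hBb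
  -- `N₁` and `N₂` are `ρ` times the radial normal stress and the shear stress.
  set N₁ : ℝ → ℝ := fun x => (lam + 2 * mu) * (x * u x 1) + lam * u x 0 + lam * κ * (x * u x 2)
    with hN₁
  set G₁ : ℝ → ℝ := fun x => 2 * mu * (u x 0 / x) + lam * (u x 1 + u x 0 / x + κ * u x 2)
    - κ * mu * (x * (u x 3 - κ * u x 0)) with hG₁
  set N₂ : ℝ → ℝ := fun x => mu * (x * (u x 3 - κ * u x 0)) with hN₂
  set G₂ : ℝ → ℝ := fun x => lam * κ * (x * (u x 1 + u x 0 / x + κ * u x 2))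
    + 2 * mu * κ ^ 2 * (x * u x 2) with hG₂
  have cN₁ : ContinuousOn N₁ (Icc a b) := by fun_prop
  have cN₂ : ContinuousOn N₂ (Icc a b) := by fun_prop
  have cG₁ : ContinuousOn G₁ (Icc a b) := by fun_prop (disch := assumption)
  have cG₂ : ContinuousOn G₂ (Icc a b) := by fun_prop (disch := assumption)
  have dN₁ : ∀ x ∈ Ioo a b \ s, HasDerivAt N₁ (G₁ x) x := by
    intro x hx
    have hx0 : 0 < x := ha.trans hx.1.1
    have d1 := hasDerivAt_pi.1 (hu x hx0 hx.2) 1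
    have := ((((hasDerivAt_id x).mul d1).const_mul (lam + 2 * mu)).add
      ((h0 x hx0).const_mul lam)).add (((hasDerivAt_id x).mul (h2 x hx0)).const_mul (lam * κ))
    convert! this using 1
    simp [hG₁, sysMatrix, dotProduct, Fin.sum_univ_four]
    field_simp
    ring
  have dN₂ : ∀ x ∈ Ioo a b \ s, HasDerivAt N₂ (G₂ x - x * g x) x := by
    intro x hx
    have hx0 : 0 < x := ha.trans hx.1.1
    have d3 := hasDerivAt_pi.1 (hu x hx0 hx.2) 3
    have := ((hasDerivAt_id x).mul (d3.sub ((h0 x hx0).const_mul κ))).const_mul mu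
    convert! this using 1
    simp [hG₂, sysMatrix, dotProduct, Fin.sum_univ_four]
    field_simp
    ring
  have hgb : ∀ v : ℝ → ℝ, IntegrableOn v (Ioo a b) →
      IntegrableOn (fun x => x * g x * v x) (Ioo a b) := fun v hv => by
    have h1 : IntegrableOn (fun x => g x * v x) (Ioo a b) :=
      Integrable.bdd_mul hv hgm.aestronglyMeasurable (ae_of_all _ hgM)
    simpa only [mul_assoc, id] using integrableOn_continuousOn_mul continuousOn_id h1
  have iG₂ : IntegrableOn (fun x => G₂ x - x * g x) (Ioo a b) := by
    have e1 := hgb (fun _ => 1) (integrableOn_const (by simp))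
    simp only [mul_one] at e1
    exact (cG₂.integrableOn_Icc.mono_set Ioo_subset_Icc_self).sub e1
  have hY : IsH1With a b (fun r => u r 0) (fun r => u r 1) :=
    isH1With_of_hasDerivAt hab (fun x hx => h0 x (hsub hx)) c1
  have hZ : IsH1With a b (fun r => u r 2) (fun r => u r 3) :=
    isH1With_of_hasDerivAt hab (fun x hx => h2 x (hsub hx)) c3
  refine ⟨fun r => u r 1, fun r => u r 3, hY, hZ, fun H H' K K' hH hK => ?_⟩
  rw [(integrableOn_energyDensity ha hY.memLp hY.memLp_deriv hZ.memLp hZ.memLp_deriv hH.memLp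
    hH.memLp_deriv hK.memLp hK.memLp_deriv).2]
  have p₁ := hH.integral_mul_deriv hab hs cN₁ dN₁
    (cG₁.integrableOn_Icc.mono_set Ioo_subset_Icc_self)
    (by
      simp only [hN₁]
      have := hBa.1
      field_simp at this
      linear_combination this)
    (by
      simp only [hN₁]
      have := hBb.1
      field_simp at this
      linear_combination this)
  have p₂ := hK.integral_mul_deriv hab hs cN₂ dN₂ iG₂
    (by simp only [hN₂, hBa.2, mul_zero]) (by simp only [hN₂, hBb.2, mul_zero])
  have iH := integrableOn_of_memLp_two hH.memLp
  have iK := integrableOn_of_memLp_two hK.memLp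
  have iG₂K := integrableOn_continuousOn_mul cG₂ iK
  have hsplit := (integrable_and_integral_linear_combination
    (integrableOn_continuousOn_mul cN₁ (integrableOn_of_memLp_two hH.memLp_deriv))
    (integrableOn_continuousOn_mul cG₁ iH)
    (integrableOn_continuousOn_mul cN₂ (integrableOn_of_memLp_two hK.memLp_deriv))
    iG₂K 1 1 1 1).2
  have p₃ : ∫ x in Ioo a b, (G₂ x - x * g x) * K x =
      (∫ x in Ioo a b, G₂ x * K x) - ∫ x in Ioo a b, x * g x * K x := by
    rw [← integral_sub iG₂K (hgb K iK)]
    simp only [sub_mul]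
  have p₄ : ∫ ρ in Ioo a b, energyDensity lam mu κ ρ (u ρ 0) (u ρ 1) (u ρ 2) (u ρ 3) (H ρ) (H' ρ)
      (K ρ) (K' ρ) = ∫ x in Ioo a b, (1 * (N₁ x * H' x) + 1 * (G₁ x * H x) + 1 * (N₂ x * K' x) +
        1 * (G₂ x * K x)) := by
    refine setIntegral_congr_fun measurableSet_Ioo fun x hx => ?_
    have hx0 : x ≠ 0 := hne x (Ioo_subset_Icc_self hx)
    simp only [energyDensity, hN₁, hG₁, hN₂, hG₂]
    field_simp
    ring
  rw [p₄, ← hsplit]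
  linarith

theorem isRadialBVPSolution_zero (a b lam mu κ : ℝ) :
    IsRadialBVPSolution a b lam mu κ 0 0 0 := by
  have h : IsH1With a b 0 0 := ⟨MemLp.zero, MemLp.zero, fun φ _ _ _ => by simp⟩
  exact ⟨0, 0, h, h, fun H H' K K' _ _ => by simp⟩

theorem eqOn_Ioo_of_ae_eq {a b : ℝ} {f g : ℝ → ℝ} (hf : ContinuousOn f (Ioo a b))
    (hg : ContinuousOn g (Ioo a b)) (h : ∀ᵐ x ∂(volume.restrict (Ioo a b)), f x = g x) :
    EqOn f g (Ioo a b) :=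
  Measure.eqOn_open_of_ae_eq h isOpen_Ioo hf hg

/-- Continuity upgrades the relation to all of `(a, b)`; differentiating it at the midpoint kills
the remaining two Cauchy data, so the Wronskian argument applies. -/
theorem IsFundamentalSystem.eq_zero_of_ae {lam mu κ : ℝ} {Y Z : Fin 4 → ℝ → ℝ}
    (h : IsFundamentalSystem lam mu κ Y Z) {a b : ℝ} (ha : 0 < a) (hab : a < b) {C : Fin 4 → ℝ}
    (hC : ∀ᵐ ρ ∂(volume.restrict (Ioo a b)), ∑ j, C j * Y j ρ = 0 ∧ ∑ j, C j * Z j ρ = 0) :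
    C = 0 := by
  have hd : ∀ ρ, 0 < ρ → HasDerivAt (fun r => (wronskian Y Z r).mulVec C)
      ((sysMatrix lam mu κ ρ).mulVec ((wronskian Y Z ρ).mulVec C)) ρ :=
    fun ρ hρ => hasDerivAt_wronskian_mulVec h.solves C hρ
  have hpos : ∀ x ∈ Ioo a b, 0 < x := fun x hx => ha.trans hx.1
  have hcont : ∀ i, ContinuousOn (fun r => (wronskian Y Z r).mulVec C i) (Ioo a b) := fun i x hx =>
    (hasDerivAt_pi.1 (hd x (hpos x hx)) i).continuousAt.continuousWithinAt
  have e0 : ∀ r, (wronskian Y Z r).mulVec C 0 = ∑ j, C j * Y j r := fun r => by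
    rw [wronskian_mulVec]; simp [state]
  have e2 : ∀ r, (wronskian Y Z r).mulVec C 2 = ∑ j, C j * Z j r := fun r => by
    rw [wronskian_mulVec]; simp [state]
  have z0 := eqOn_Ioo_of_ae_eq (hcont 0) continuousOn_const (g := fun _ => 0)
    (hC.mono fun x hx => (e0 x).trans hx.1)
  have z2 := eqOn_Ioo_of_ae_eq (hcont 2) continuousOn_const (g := fun _ => 0)
    (hC.mono fun x hx => (e2 x).trans hx.2)
  have hm : (a + b) / 2 ∈ Ioo a b := ⟨by linarith, by linarith⟩
  have hnhds := isOpen_Ioo.mem_nhds hm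
  have d0 := hasDerivAt_pi.1 (hd _ (hpos _ hm)) 0
  have d2 := hasDerivAt_pi.1 (hd _ (hpos _ hm)) 2
  have z1 := d0.unique ((hasDerivAt_const _ (0 : ℝ)).congr_of_eventuallyEq
    (Filter.eventuallyEq_of_mem hnhds z0))
  have z3 := d2.unique ((hasDerivAt_const _ (0 : ℝ)).congr_of_eventuallyEq
    (Filter.eventuallyEq_of_mem hnhds z2))
  refine h.eq_zero (hpos _ hm) (funext fun i => ?_)
  fin_cases i
  · exact z0 hm
  · generalize (wronskian Y Z ((a + b) / 2)).mulVec C = w at z1 ⊢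
    simpa [sysMatrix, Matrix.mulVec, dotProduct, Fin.sum_univ_four] using z1
  · exact z2 hm
  · generalize (wronskian Y Z ((a + b) / 2)).mulVec C = w at z3 ⊢
    simpa [sysMatrix, Matrix.mulVec, dotProduct, Fin.sum_univ_four] using z3

theorem IsFundamentalSystem.isRadialBVPSolution_combination {a b lam mu κ : ℝ} (ha : 0 < a)
    (hab : a < b) (hmu : mu ≠ 0) (hlm : lam + 2 * mu ≠ 0) {Y Z : Fin 4 → ℝ → ℝ}
    (h : IsFundamentalSystem lam mu κ Y Z) {C : Fin 4 → ℝ}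
    (hBa : boundaryOp lam mu κ a ((wronskian Y Z a).mulVec C) = 0)
    (hBb : boundaryOp lam mu κ b ((wronskian Y Z b).mulVec C) = 0) :
    IsRadialBVPSolution a b lam mu κ 0 (fun r => ∑ j, C j * Y j r) (fun r => ∑ j, C j * Z j r) := by
  have hd : ∀ ρ, 0 < ρ → HasDerivAt (fun r => (wronskian Y Z r).mulVec C)
      ((sysMatrix lam mu κ ρ).mulVec ((wronskian Y Z ρ).mulVec C)) ρ :=
    fun ρ hρ => hasDerivAt_wronskian_mulVec h.solves C hρ
  have := isRadialBVPSolution_of_classical ha hab hmu hlm (g := 0) measurable_zero (M := 0)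
    (by simp) countable_empty (u := fun r => (wronskian Y Z r).mulVec C)
    (fun x hx => (hd x hx).continuousAt.continuousWithinAt)
    (fun ρ hρ => by
      have := hasDerivAt_pi.1 (hd ρ hρ) 0
      generalize (wronskian Y Z ρ).mulVec C = w at this ⊢
      simpa [sysMatrix, Matrix.mulVec, dotProduct, Fin.sum_univ_four] using this)
    (fun ρ hρ => by
      have := hasDerivAt_pi.1 (hd ρ hρ) 2
      generalize (wronskian Y Z ρ).mulVec C = w at this ⊢
      simpa [sysMatrix, Matrix.mulVec, dotProduct, Fin.sum_univ_four] using this)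
    (fun ρ hρ _ => by
      convert! hd ρ hρ using 1
      rw [add_eq_left]
      ext i; fin_cases i <;> simp) hBa hBb
  simpa [wronskian_mulVec, state] using this

/-! ### Existence for the boundary value problem and conclusion -/

theorem IsFundamentalSystem.exists_isRadialBVPSolution {a b lam mu κ : ℝ} (ha : 0 < a)
    (hab : a < b) (hmu : 0 < mu) (hlam : 0 < 3 * lam + 2 * mu) (hκ : κ ≠ 0)
    {Y Z : Fin 4 → ℝ → ℝ} (h : IsFundamentalSystem lam mu κ Y Z) {g : ℝ → ℝ}
    (hgm : Measurable g) {M : ℝ} (hgM : ∀ x, ‖g x‖ ≤ M)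
    (hgi : ∀ x y, IntervalIntegrable g volume x y) {s : Set ℝ} (hs : s.Countable)
    (hgs : ∀ x, x ∉ s → ContinuousAt g x) :
    ∃ C : Fin 4 → ℝ, IsRadialBVPSolution a b lam mu κ g
      (fun ρ => (∑ j, C j * Y j ρ) + particular a mu g Y Z ρ 0)
      (fun ρ => (∑ j, C j * Z j ρ) + particular a mu g Y Z ρ 2) := by
  have hlm : lam + 2 * mu ≠ 0 := by intro hcon; linarith
  let L : (Fin 4 → ℝ) →ₗ[ℝ] (Fin 2 → ℝ) × (Fin 2 → ℝ) :=
    (boundaryOp lam mu κ a ∘ₗ (wronskian Y Z a).mulVecLin).prod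
      (boundaryOp lam mu κ b ∘ₗ (wronskian Y Z b).mulVecLin)
  -- A kernel element solves the boundary value problem with zero load, hence vanishes by the energy
  -- argument.
  have hinj : Function.Injective L := by
    rw [← LinearMap.ker_eq_bot, LinearMap.ker_eq_bot']
    intro C hC
    have hC' := Prod.ext_iff.1 hC
    have hsol := h.isRadialBVPSolution_combination ha hab hmu.ne' hlm (C := C) hC'.1 hC'.2
    exact h.eq_zero_of_ae ha hab
      (hsol.unique ha hmu hlam hκ (isRadialBVPSolution_zero a b lam mu κ))
  have hsurj : Function.Surjective L :=
    (LinearMap.injective_iff_surjective_of_finrank_eq_finrank (by simp)).1 hinj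
  set P := particular a mu g Y Z with hP
  -- The homogeneous part is chosen to cancel the boundary values of the particular solution.
  obtain ⟨C, hC⟩ := hsurj (-(boundaryOp lam mu κ a (P a)), -(boundaryOp lam mu κ b (P b)))
  have hC' := Prod.ext_iff.1 hC
  have hCa : boundaryOp lam mu κ a ((wronskian Y Z a).mulVec C) = -boundaryOp lam mu κ a (P a) :=
    hC'.1
  have hCb : boundaryOp lam mu κ b ((wronskian Y Z b).mulVec C) = -boundaryOp lam mu κ b (P b) :=
    hC'.2
  refine ⟨C, ?_⟩
  have hd : ∀ ρ, 0 < ρ → HasDerivAt (fun r => (wronskian Y Z r).mulVec C)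
      ((sysMatrix lam mu κ ρ).mulVec ((wronskian Y Z ρ).mulVec C)) ρ :=
    fun ρ hρ => hasDerivAt_wronskian_mulVec h.solves C hρ
  have hPd := fun ρ (hρ : 0 < ρ) => h.hasDerivAt_particular_fst (mu := mu) hgm hgi hs hgs ha hρ
  have := isRadialBVPSolution_of_classical ha hab hmu.ne' hlm hgm hgM hs
    (u := fun r => (wronskian Y Z r).mulVec C + P r)
    (ContinuousOn.add (fun x hx => (hd x hx).continuousAt.continuousWithinAt)
      (h.continuousOn_particular hgi ha))
    (fun ρ hρ => by
      have := hasDerivAt_pi.1 (hd ρ hρ) 0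
      have h1 := this.add (hPd ρ hρ).1
      convert! h1 using 1
      generalize (wronskian Y Z ρ).mulVec C = w
      simp [sysMatrix, Matrix.mulVec, dotProduct, Fin.sum_univ_four, hP])
    (fun ρ hρ => by
      have := hasDerivAt_pi.1 (hd ρ hρ) 2
      have h1 := this.add (hPd ρ hρ).2
      convert! h1 using 1
      generalize (wronskian Y Z ρ).mulVec C = w
      simp [sysMatrix, Matrix.mulVec, dotProduct, Fin.sum_univ_four, hP])
    (fun ρ hρ hρs => by
      have h1 := (hd ρ hρ).add (h.hasDerivAt_particular hgm hgi ha hρ (hgs ρ hρs))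
      rw [← add_assoc, ← Matrix.mulVec_add] at h1
      exact h1)
    (by rw [map_add, hCa, neg_add_cancel]) (by rw [map_add, hCb, neg_add_cancel])
  simpa [wronskian_mulVec, state] using this

end HollowCylinder

end

theorem lemma3p7 (E ν lam mu a b ε h p : ℝ) (hE : 0 < E) (hν : -1 < ν) (hν' : ν < 1 / 2)
    (hlam : lam = E * ν / ((1 + ν) * (1 - 2 * ν))) (hmu : mu = E / (2 * (1 + ν)))
    (ha : 0 < a) (haε : a < ε) (hεb : ε < b) (hh : 0 < h) (hp : 0 ≤ p)
    (k : ℕ) (hk : Odd k) (κ : ℝ) (hκ : κ = Real.pi * k / h) :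
    -- the boundary value problem has a unique solution in `H¹(a, b; ℝ²)`
    ((∃ Y Z : ℝ → ℝ,
        HollowCylinder.IsRadialBVPSolution a b lam mu κ (HollowCylinder.Psi a ε h p k) Y Z) ∧
      ∀ Y Z Y₁ Z₁ : ℝ → ℝ,
        HollowCylinder.IsRadialBVPSolution a b lam mu κ (HollowCylinder.Psi a ε h p k) Y Z →
        HollowCylinder.IsRadialBVPSolution a b lam mu κ (HollowCylinder.Psi a ε h p k) Y₁ Z₁ →
        ∀ᵐ ρ ∂(MeasureTheory.volume.restrict (Set.Ioo a b)), Y ρ = Y₁ ρ ∧ Z ρ = Z₁ ρ) ∧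
    -- representation of the solution through any four independent homogeneous solutions
    (∀ Υ₁ Υ₂ : Fin 4 → ℝ → ℝ, HollowCylinder.IsFundamentalSystem lam mu κ Υ₁ Υ₂ →
      -- the variation-of-constants formula is meaningful
      (∀ ρ : ℝ, 0 < ρ → IsUnit (HollowCylinder.wronskian Υ₁ Υ₂ ρ).det ∧
        IntervalIntegrable (HollowCylinder.variationIntegrand mu
          (HollowCylinder.Psi a ε h p k) Υ₁ Υ₂) MeasureTheory.volume a ρ) ∧
      -- its components are `Ȳ, Ȳ', Z̄, Z̄'`, and `(Ȳ, Z̄)` solves the inhomogeneous system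
      (∀ ρ : ℝ, 0 < ρ →
        HasDerivAt
          (fun r => HollowCylinder.particular a mu (HollowCylinder.Psi a ε h p k) Υ₁ Υ₂ r 0)
          (HollowCylinder.particular a mu (HollowCylinder.Psi a ε h p k) Υ₁ Υ₂ ρ 1) ρ ∧
        HasDerivAt
          (fun r => HollowCylinder.particular a mu (HollowCylinder.Psi a ε h p k) Υ₁ Υ₂ r 2)
          (HollowCylinder.particular a mu (HollowCylinder.Psi a ε h p k) Υ₁ Υ₂ ρ 3) ρ) ∧
      (∀ ρ : ℝ, 0 < ρ → ρ ≠ a → ρ ≠ ε →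
        HollowCylinder.SolvesRadialSystemAt lam mu κ (HollowCylinder.Psi a ε h p k ρ)
          (fun r => HollowCylinder.particular a mu (HollowCylinder.Psi a ε h p k) Υ₁ Υ₂ r 0)
          (fun r => HollowCylinder.particular a mu (HollowCylinder.Psi a ε h p k) Υ₁ Υ₂ r 2)
          ρ) ∧
      -- the superposition formula with unique constants
      (∀ Y Z : ℝ → ℝ,
        HollowCylinder.IsRadialBVPSolution a b lam mu κ (HollowCylinder.Psi a ε h p k) Y Z →
        ∃! C : Fin 4 → ℝ, ∀ᵐ ρ ∂(MeasureTheory.volume.restrict (Set.Ioo a b)),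
          Y ρ = (∑ j, C j * Υ₁ j ρ) +
            HollowCylinder.particular a mu (HollowCylinder.Psi a ε h p k) Υ₁ Υ₂ ρ 0 ∧
          Z ρ = (∑ j, C j * Υ₂ j ρ) +
            HollowCylinder.particular a mu (HollowCylinder.Psi a ε h p k) Υ₁ Υ₂ ρ 2)) ∧
    -- every homogeneous solution has a logarithmic expansion, with unique coefficients
    (∀ Y Z : ℝ → ℝ, HollowCylinder.IsHomogeneousSolution lam mu κ Y Z →
      ∃! q : HollowCylinder.LogCoeffs, HollowCylinder.HasLogExpansion q Y Z) ∧
    -- the free coefficients `(a₋₁, a₁, b₁, c₀)` are arbitrary and determine all the others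
    (∀ f : Fin 4 → ℝ, ∃! q : HollowCylinder.LogCoeffs, q.free = f ∧ q.Converges ∧
      HollowCylinder.IsHomogeneousSolution lam mu κ q.sumY q.sumZ) ∧
    -- the choices `f = e_j` give four linearly independent solutions
    (∃ q : Fin 4 → HollowCylinder.LogCoeffs,
      (∀ j, (q j).Converges ∧ (q j).free = Pi.single j 1) ∧
      HollowCylinder.IsFundamentalSystem lam mu κ (fun j => (q j).sumY)
        (fun j => (q j).sumZ)) := by
  have h1ν : 0 < 1 + ν := by linarith
  have h2ν : 0 < 1 - 2 * ν := by linarith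
  have hmu0 : 0 < mu := by rw [hmu]; positivity
  -- Three times the bulk modulus; its positivity is where `ν < 1 / 2` matters, `lam` itself
  -- possibly being negative.
  have hlm3 : 0 < 3 * lam + 2 * mu := by
    have e : 3 * lam + 2 * mu = E / (1 - 2 * ν) := by
      have := h2ν.ne'
      have := h1ν.ne'
      rw [hlam, hmu]
      generalize ht : 1 - 2 * ν = t at *
      field_simp
      linear_combination -ht
    rw [e]; positivity
  have hlm2 : 0 < lam + 2 * mu := by linarith
  have hlm1 : 0 < lam + mu := by linarith
  have hκ0 : 0 < κ := by
    have : 0 < (k : ℝ) := by exact_mod_cast hk.pos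
    rw [hκ]; have := Real.pi_pos; positivity
  have hab : a < b := haε.trans hεb
  -- This is the coefficient by which the resonant equation is divided to obtain `d₀`.
  have hB : (lam + mu) / (lam + 2 * mu) * κ ≠ 0 := by positivity
  have hs : ({a, ε} : Set ℝ).Countable := (Set.toFinite _).countable
  have hgm := HollowCylinder.measurable_Psi a ε h p k
  have hgM := HollowCylinder.norm_Psi_le a ε h p k
  have hgi := HollowCylinder.intervalIntegrable_Psi a ε h p k
  have hgs : ∀ x, x ∉ ({a, ε} : Set ℝ) → ContinuousAt (HollowCylinder.Psi a ε h p k) x :=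
    fun x hx => HollowCylinder.continuousAt_Psi a ε h p k hx
  choose q hqf hqc hqs using fun j : Fin 4 =>
    HollowCylinder.exists_frobenius_solution hB (Pi.single j (1 : ℝ))
  have hfund := HollowCylinder.isFundamentalSystem_of_free hqc hqf hqs
  have huniq : ∀ Y Z Y₁ Z₁ : ℝ → ℝ,
      HollowCylinder.IsRadialBVPSolution a b lam mu κ (HollowCylinder.Psi a ε h p k) Y Z →
      HollowCylinder.IsRadialBVPSolution a b lam mu κ (HollowCylinder.Psi a ε h p k) Y₁ Z₁ →
      ∀ᵐ ρ ∂(MeasureTheory.volume.restrict (Set.Ioo a b)), Y ρ = Y₁ ρ ∧ Z ρ = Z₁ ρ :=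
    fun Y Z Y₁ Z₁ h₁ h₂ => h₁.unique ha hmu0 hlm3 hκ0.ne' h₂
  have hexpand : ∀ Y Z : ℝ → ℝ, HollowCylinder.IsHomogeneousSolution lam mu κ Y Z →
      ∃ C : Fin 4 → ℝ,
        HollowCylinder.HasLogExpansion (HollowCylinder.LogCoeffs.combination C q) Y Z := by
    intro Y Z hYZ
    obtain ⟨C, hC⟩ := hfund.exists_combination hYZ
    exact ⟨C, (HollowCylinder.LogCoeffs.hasLogExpansion_combination hqc).congr hC⟩
  refine ⟨⟨?_, huniq⟩, ?_, ?_, ?_, ⟨q, fun j => ⟨hqc j, hqf j⟩, hfund⟩⟩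
  · obtain ⟨C, hC⟩ := hfund.exists_isRadialBVPSolution ha hab hmu0 hlm3 hκ0.ne' hgm hgM hgi hs hgs
    exact ⟨_, _, hC⟩
  · intro Υ₁ Υ₂ hΥ
    refine ⟨fun ρ hρ => ⟨hΥ.isUnit_det hρ, hΥ.intervalIntegrable_variationIntegrand hgi ha hρ⟩,
      fun ρ hρ => hΥ.hasDerivAt_particular_fst hgm hgi hs hgs ha hρ,
      fun ρ hρ hρa hρε => hΥ.solvesRadialSystemAt_particular hgm hgi hs hgs ha hρ
        (by simp [hρa, hρε]), fun Y Z hYZ => ?_⟩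
    obtain ⟨C, hC⟩ := hΥ.exists_isRadialBVPSolution ha hab hmu0 hlm3 hκ0.ne' hgm hgM hgi hs hgs
    have hYC := huniq _ _ _ _ hYZ hC
    refine ⟨C, hYC, fun C' hC' => ?_⟩
    rw [← sub_eq_zero]
    refine hΥ.eq_zero_of_ae ha hab ?_
    filter_upwards [hYC, hC'] with ρ h₁ h₂
    simp only [Pi.sub_apply, sub_mul, Finset.sum_sub_distrib]
    exact ⟨by linarith [h₁.1, h₂.1], by linarith [h₁.2, h₂.2]⟩
  · intro Y Z hYZ
    obtain ⟨C, hC⟩ := hexpand Y Z hYZ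
    exact ⟨_, hC, fun q' hq' => hq'.unique hC⟩
  · intro f
    obtain ⟨q₀, hf, hc, hs₀⟩ := HollowCylinder.exists_frobenius_solution hB f
    -- Any admissible `q'` expands in the unit-vector solutions, and comparing free coefficients
    -- shows that the constants are `f`.
    have hcomb : ∀ q' : HollowCylinder.LogCoeffs, q'.free = f → q'.Converges →
        HollowCylinder.IsHomogeneousSolution lam mu κ q'.sumY q'.sumZ →
        q' = HollowCylinder.LogCoeffs.combination f q := by
      intro q' hf' hc' hs'
      obtain ⟨C, hC⟩ := hexpand _ _ hs'
      have e : q' = HollowCylinder.LogCoeffs.combination C q :=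
        HollowCylinder.HasLogExpansion.unique ⟨hc', fun ρ _ => ⟨rfl, rfl⟩⟩ hC
      have : C = f := by
        rw [← hf', e, HollowCylinder.LogCoeffs.free_combination C hqf]
      rw [e, this]
    exact ⟨q₀, ⟨hf, hc, hs₀⟩, fun q' ⟨hf', hc', hs'⟩ =>
      (hcomb q' hf' hc' hs').trans (hcomb q₀ hf hc hs₀).symm⟩
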